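/- **Theorem 2 (Exchange of limits).** *Channel.* Consider the binary symmetric channel BSC($\epsilon$), $0<\epsilon<\tfrac12$. The half-loglikelihood of a received bit, when the all-$(+1)$ codeword is sent, has distribution $$c_\epsilon=(1-\epsilon)\,\delta_{\frac12\ln\frac{1-\epsilon}{\epsilon}}+\epsilon\,\delta_{\frac12\ln\frac{\epsilon}{1-\epsilon}} .$$ *Codes.* An LDGM code is given by a bipartite graph $G$ (parallel edges allowed) with $m$ variable nodes and $n$ check nodes: information bits $u_a\in\{\pm1\}$ sit on the variable nodes, and the code-bit of check node $i$ is $x_i=\prod_{a\in\partial i}u_a$ (one factor per edge at $i$). Let $\Lambda(z)=\sum_{l=1}^{l_{\max}}\Lambda_lz^l$ and $P(z)=\sum_{r=1}^{k_{\max}}P_rz^r$ have non-negative coefficients with $\Lambda(1)=P(1)=1$. An LDGM($\Lambda,P$) ensemble is a sequence of degree assignments with $n\to\infty$ check nodes and $m=m(n)$ variable nodes, all variable degrees in $\{1,\dots,l_{\max}\}$ and all check degrees in $\{1,\dots,k_{\max}\}$, with equal total degree on both sides, such that the fraction of variable nodes of degree $l$ tends to $\Lambda_l$ and the fraction of check nodes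 of degree $r$ tends to $P_r$ (in particular, these fractions may equal $\Lambda_l$, $P_r$ exactly, in which case $m/n=P'(1)/\Lambda'(1)$). The random code is obtained by matching the edge sockets of the two sides uniformly at random; $\mathbb E_{\mathcal C}$ is the expectation over this matching and over a uniformly random check node $i$. *BP-GEXIT function.* For a check node $i$ and $d\ge0$ let $T_d(i)$ be the computational tree, i.e. the universal covering tree of $G$ truncated at distance $d$ from $i$, with projection $\pi:T_d(i)\to G$. For half-loglikelihoods $l=(l_1,\dots,l_n)$ let $\langle\cdot\rangle^{BP}_d$ be the average with respect to the Gibbs measure $$\frac1{Z_{T_d(i)}}\prod_{k\in T_d(i)}e^{\,l_{\pi(k)}\prod_{a\in\partial k}u_a}$$ on the spins $u_a=\pm1$ at the variable nodes of $T_d(i)$; here $k$ runs over the check nodes of $T_d(i)$ and $\partial k$ is the set of neighbours of $k$ in $T_d(i)$. Let $\langle x_i\rangle^{BP}_{0,d}$ be the average of the code-bit at the root, computed with $l_i=0$. Define $$g^{BP}_{n,d}(\epsilon)=\mathbb E_{\mathcal C}\left[\frac{\Lambda'(1)}{P'(1)}\int dl_i\,\frac{dc_\epsilon(l_i)}{d\epsilon}\;\mathbb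 E_{l^{n\setminus i}}\ln\frac{1+\langle x_i\rangle^{BP}_{0,d}\tanh l_i}{1+\tanh l_i}\right],$$ where $\mathbb E_{l^{n\setminus i}}$ is the expectation over i.i.d. $l_j\sim c_\epsilon$, $j\ne i$, and $\int dl\,\frac{dc_\epsilon(l)}{d\epsilon}F(l)$ means $\frac{d}{d\epsilon'}\big|_{\epsilon'=\epsilon}\int F\,dc_{\epsilon'}$ with $F$ held fixed. *Claim.* There is $\epsilon_g''\in[0,\tfrac12)$, depending only on $l_{\max}$ and $k_{\max}$, such that for every such $\Lambda$, $P$ and every LDGM($\Lambda,P$) ensemble, and for all $\epsilon_g''<\epsilon<\tfrac12$, the function $d\mapsto g^{BP}_{n,d}(\epsilon)$ is bounded for each $n$, all the limits below exist (including $\lim_{n}g^{BP}_{n,d}(\epsilon)$ for every $d$), are finite, and $$\lim_{d\to\infty}\lim_{n\to\infty}g^{BP}_{n,d}(\epsilon)=\lim_{n\to\infty}\limsup_{d\to\infty}g^{BP}_{n,d}(\epsilon)=\lim_{n\to\infty}\liminf_{d\to\infty}g^{BP}_{n,d}(\epsilon).$$ -/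

import Mathlib

open Filter Topology

noncomputable section

/-- A bipartite (multi)graph with variable nodes `V`, check nodes `C` and edges `E`. Parallel edges
are allowed, as they occur in the socket (configuration) construction of random codes. -/
structure TannerGraph (V C E : Type) where
  /-- the variable node at which an edge ends -/
  var : E → V
  /-- the check node at which an edge ends -/
  chk : E → C

namespace TannerGraph

section Gibbs

variable {V C E : Type} [Fintype V] [Fintype C] [Fintype E]

open Classical in
/-- The code-bit `x_j = ∏_{a ∈ ∂j} u_a` attached to the check node `j`, as a real number `±1`. The
information bits `u` take values in `ℤˣ = {1, -1}`; the product runs over the edges at `j`. -/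
def codeBit (G : TannerGraph V C E) (u : V → ℤˣ) (j : C) : ℝ :=
  ∏ e ∈ Finset.univ.filter (fun e => G.chk e = j), (((u (G.var e) : ℤˣ) : ℤ) : ℝ)

/-- The unnormalized Gibbs weight `∏_j exp (l_j x_j)` for half-loglikelihoods `l`. -/
def gibbsWeight (G : TannerGraph V C E) (l : C → ℝ) (u : V → ℤˣ) : ℝ :=
  ∏ j, Real.exp (l j * G.codeBit u j)

open Classical in
/-- The Gibbs bracket `⟨f⟩`. -/
def bracket (G : TannerGraph V C E) (l : C → ℝ) (f : (V → ℤˣ) → ℝ) : ℝ :=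
  (∑ u, f u * G.gibbsWeight l u) / ∑ u, G.gibbsWeight l u

end Gibbs

section Tree

variable {V C E : Type}

/-- `G.IsNBWalk i w`: read from its last entry to its first, the list of edges `w` is a
non-backtracking walk in `G` that starts at the check node `i`. The walk ends at a check node if
its length is even and at a variable node if its length is odd. -/
def IsNBWalk (G : TannerGraph V C E) (i : C) : List E → Prop
  | [] => True
  | [e] => G.chk e = i
  | e' :: e :: w => IsNBWalk G i (e :: w) ∧ e' ≠ e ∧
      if Even w.length then G.var e' = G.var e else G.chk e' = G.chk e

theorem IsNBWalk.tail {G : TannerGraph V C E} {i : C} {w : List E} (h : G.IsNBWalk i w) :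
    G.IsNBWalk i w.tail := by
  match w, h with
  | [], _ => trivial
  | [_], _ => trivial
  | _ :: _ :: _, h => exact h.1

/-- The nodes of the universal covering tree of `G` (rooted at the check node `i`) at distance at
most `d` from the root: the non-backtracking walks from `i` of length at most `d`. The distance of
a node from the root is the length of the walk, and the parent of `e :: w` is `w`. -/
def treeNodes (G : TannerGraph V C E) (i : C) (d : ℕ) : Set (List E) :=
  {w | G.IsNBWalk i w ∧ w.length ≤ d}

/-- Variable nodes of the computational tree. -/
def TreeVar (G : TannerGraph V C E) (i : C) (d : ℕ) : Type :=
  {w : List E // w ∈ G.treeNodes i d ∧ Odd w.length}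

/-- Check nodes of the computational tree. -/
def TreeChk (G : TannerGraph V C E) (i : C) (d : ℕ) : Type :=
  {w : List E // w ∈ G.treeNodes i d ∧ Even w.length}

/-- Edges of the computational tree: each node `w` other than the root is joined to `w.tail`. -/
def TreeEdge (G : TannerGraph V C E) (i : C) (d : ℕ) : Type :=
  {w : List E // w ∈ G.treeNodes i d ∧ w ≠ []}

theorem finite_treeNodes [Finite E] (G : TannerGraph V C E) (i : C) (d : ℕ) :
    (G.treeNodes i d).Finite :=
  (List.finite_length_le E d).subset fun _ h => h.2

instance [Finite E] (G : TannerGraph V C E) (i : C) (d : ℕ) : Fintype (G.TreeVar i d) :=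
  ((G.finite_treeNodes i d).subset fun _ h => h.1).fintype

instance [Finite E] (G : TannerGraph V C E) (i : C) (d : ℕ) : Fintype (G.TreeChk i d) :=
  ((G.finite_treeNodes i d).subset fun _ h => h.1).fintype

instance [Finite E] (G : TannerGraph V C E) (i : C) (d : ℕ) : Fintype (G.TreeEdge i d) :=
  ((G.finite_treeNodes i d).subset fun _ h => h.1).fintype

theorem tail_mem_treeNodes {G : TannerGraph V C E} {i : C} {d : ℕ} {w : List E}
    (h : w ∈ G.treeNodes i d) : w.tail ∈ G.treeNodes i d :=
  ⟨h.1.tail, by have := h.2; rw [List.length_tail]; omega⟩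

theorem even_length_tail {w : List E} (h : Odd w.length) : Even w.tail.length := by
  rw [List.length_tail]; exact Nat.Odd.sub_odd h odd_one

theorem odd_length_tail {w : List E} (hw : w ≠ []) (h : ¬ Odd w.length) :
    Odd w.tail.length := by
  rw [List.length_tail]
  exact Nat.Even.sub_odd (List.length_pos_iff.mpr hw) (Nat.not_odd_iff_even.mp h) odd_one

open Classical in
/-- The computational tree `T_d(i)`: the universal covering tree of `G` truncated at distance `d`
from the check node `i`, again as a bipartite graph. -/
def compTree (G : TannerGraph V C E) (i : C) (d : ℕ) :
    TannerGraph (G.TreeVar i d) (G.TreeChk i d) (G.TreeEdge i d) where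
  var w := if h : Odd w.1.length then ⟨w.1, w.2.1, h⟩
    else ⟨w.1.tail, tail_mem_treeNodes w.2.1, odd_length_tail w.2.2 h⟩
  chk w := if h : Odd w.1.length then ⟨w.1.tail, tail_mem_treeNodes w.2.1, even_length_tail h⟩
    else ⟨w.1, w.2.1, Nat.not_odd_iff_even.mp h⟩

/-- The root of the computational tree. -/
def treeRoot (G : TannerGraph V C E) (i : C) (d : ℕ) : G.TreeChk i d :=
  ⟨[], ⟨trivial, Nat.zero_le d⟩, Even.zero⟩

/-- The end point in `G` of a walk of even length, given as a list of edges. -/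
def endChk (G : TannerGraph V C E) (i : C) : List E → C
  | [] => i
  | e :: _ => G.chk e

/-- The projection `π` of the check nodes of the computational tree to those of `G`. -/
def treeProj (G : TannerGraph V C E) (i : C) (d : ℕ) (k : G.TreeChk i d) : C :=
  G.endChk i k.1

variable [Fintype E]

/-- The BP soft-bit estimate `⟨x_i⟩_d^{BP}`: the Gibbs average of the code-bit at the root of
`T_d(i)`, the check node `k` of the tree carrying the half-loglikelihood `l_{π(k)}`. -/
def softBit (G : TannerGraph V C E) (d : ℕ) (l : C → ℝ) (i : C) : ℝ :=
  (G.compTree i d).bracket (fun k => l (G.treeProj i d k))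
    (fun u => (G.compTree i d).codeBit u (G.treeRoot i d))

open Classical in
/-- The extrinsic BP soft-bit estimate `⟨x_i⟩_{0,d}^{BP}`, computed with `l_i = 0`. -/
def extrinsicSoftBit (G : TannerGraph V C E) (d : ℕ) (l : C → ℝ) (i : C) : ℝ :=
  G.softBit d (Function.update l i 0) i

end Tree

end TannerGraph

/-- Probability that the BSC with parameter `ε` flips (`true`) or does not flip (`false`) a bit. -/
def bscProb (ε : ℝ) (flip : Bool) : ℝ := if flip then ε else 1 - ε

/-- Half-loglikelihood received over the BSC when `+1` is sent. -/
def bscLLR (ε : ℝ) (flip : Bool) : ℝ :=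
  if flip then Real.log (ε / (1 - ε)) / 2 else Real.log ((1 - ε) / ε) / 2

/-- `∫ c(l) F(l) dl`, where
`c = (1 - ε) δ_{(1/2) ln ((1 - ε) / ε)} + ε δ_{(1/2) ln (ε / (1 - ε))}`. -/
def bscMean (ε : ℝ) (F : ℝ → ℝ) : ℝ := ∑ s, bscProb ε s * F (bscLLR ε s)

/-- `∫ (dc(l)/dε) F(l) dl`: the derivative of the distribution `c` with respect to the noise
parameter, tested against a fixed function `F`. -/
def bscDerivMean (ε : ℝ) (F : ℝ → ℝ) : ℝ := deriv (fun e => bscMean e F) ε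

/-- Expectation over i.i.d. half-loglikelihoods with distribution `c`, indexed by `C`. -/
def bscExpect {C : Type} [Fintype C] [DecidableEq C] (ε : ℝ) (F : (C → ℝ) → ℝ) : ℝ :=
  ∑ s : C → Bool, (∏ j, bscProb ε (s j)) * F (fun j => bscLLR ε (s j))

/-- The degree distribution polynomial `∑_{j=1}^{dmax} p_j z^j` of a probability vector `p`. -/
structure IsDegreeDist (dmax : ℕ) (p : Polynomial ℝ) : Prop where
  coeff_nonneg : ∀ j, 0 ≤ p.coeff j
  coeff_zero : p.coeff 0 = 0
  natDegree_le : p.natDegree ≤ dmax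
  eval_one : p.eval 1 = 1

/-- Node degrees of a bipartite graph with `n` check nodes and `m` variable nodes. -/
structure NodeDegrees (n m : ℕ) where
  varDeg : Fin m → ℕ
  chkDeg : Fin n → ℕ
  sum_eq : ∑ i, chkDeg i = ∑ a, varDeg a

namespace NodeDegrees

variable {n m : ℕ}

/-- Sockets of the variable nodes. -/
abbrev VarSocket (D : NodeDegrees n m) : Type := Σ a : Fin m, Fin (D.varDeg a)

/-- Sockets of the check nodes. -/
abbrev ChkSocket (D : NodeDegrees n m) : Type := Σ i : Fin n, Fin (D.chkDeg i)

/-- The graph obtained by joining every check socket to the variable socket matched with it. -/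
def graph (D : NodeDegrees n m) (σ : D.ChkSocket ≃ D.VarSocket) :
    TannerGraph (Fin m) (Fin n) D.ChkSocket where
  var e := (σ e).1
  chk e := e.1

/-- `E_𝒞 [f]`: the average of `f` over a uniformly random matching of the sockets, and over a
uniformly random check node of the resulting graph. -/
def ensembleAvg (D : NodeDegrees n m)
    (f : TannerGraph (Fin m) (Fin n) D.ChkSocket → Fin n → ℝ) : ℝ :=
  (∑ σ : D.ChkSocket ≃ D.VarSocket, (∑ i, f (D.graph σ) i) / (n : ℝ)) /
    (Fintype.card (D.ChkSocket ≃ D.VarSocket) : ℝ)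

/-- The BP-GEXIT function `g_{n,d}^{BP}(ε)` over the BSC. -/
def bpGexit (D : NodeDegrees n m) (Λ P : Polynomial ℝ) (d : ℕ) (ε : ℝ) : ℝ :=
  D.ensembleAvg fun G i =>
    Λ.derivative.eval 1 / P.derivative.eval 1 *
      bscDerivMean ε fun li => bscExpect ε fun l =>
        Real.log ((1 + G.extrinsicSoftBit d l i * Real.tanh li) / (1 + Real.tanh li))

end NodeDegrees

/-- The node degrees `D k`, with `n k` check nodes and `m k` variable nodes, `k = 0, 1, 2, …`,
define a sequence of LDGM(`Λ`, `P`) ensembles with block lengths `n k → ∞`: all degrees are between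
`1` and the maximal degrees, and the fraction of nodes of each degree is, asymptotically, the one
that `Λ` or `P` prescribes (equality for every `k`, which fixes the design rate
`m k / n k = P'(1) / Λ'(1)`, is a special case; the limit allows for rounding). -/
structure IsLDGMSequence (lmax kmax : ℕ) (Λ P : Polynomial ℝ) (n m : ℕ → ℕ)
    (D : ∀ k, NodeDegrees (n k) (m k)) : Prop where
  tendsto_n : Tendsto n atTop atTop
  varDeg_mem : ∀ k a, (D k).varDeg a ∈ Set.Icc 1 lmax
  chkDeg_mem : ∀ k i, (D k).chkDeg i ∈ Set.Icc 1 kmax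
  tendsto_var : ∀ j, Tendsto
    (fun k => ((Finset.univ.filter fun a => (D k).varDeg a = j).card : ℝ) / (m k : ℝ))
    atTop (𝓝 (Λ.coeff j))
  tendsto_chk : ∀ j, Tendsto
    (fun k => ((Finset.univ.filter fun i => (D k).chkDeg i = j).card : ℝ) / (n k : ℝ))
    atTop (𝓝 (P.coeff j))

end

set_option linter.unusedSectionVars false

/-! The exchange is an instance of the Moore–Osgood theorem: the inner limit in the block length
exists at every fixed depth, and the sequences in the depth are Cauchy uniformly in the block
length. The two facts have unrelated proofs, and only the second needs high noise.

Both start from the fact that a Gibbs average on a tree can be computed by summing out the spins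
from the leaves. `extrinsicSoftBit_eq_prod_msg` thus writes the estimate at the root as a product of
messages `msg`, which are defined by a recursion directly on the edges of the graph, cycles or not.

Uniformity in the depth. One round of the recursion multiplies a discrepancy between messages by a
constant depending on the maximal degrees, times the size `1 - 2ε` of the soft channel outputs. For
ε close to 1/2 this product is at most 1/2, so messages computed to different depths differ by an
exponentially small amount (`abs_msg_sub_msg_le`). This holds for every graph of bounded degree and
every noise realization, not just on average. The derivative with respect to the noise is a
continuous function `gexitKernel` of the estimate on [-1, 1], so the bound carries over to the GEXIT
functions (`exists_abs_bpGexit_sub_le`).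

Limit in the block length. At fixed depth, the messages are found by exploring a bounded number of
nodes. Each new socket is matched with a fresh node except with probability O(1/N), where N is the
number of edges, and the degree of a fresh node is size-biased. Hence the ensemble average is within
O(1/N) of a mean over a random tree with the empirical degree fractions
(`abs_ensembleAvg_sub_treeMean_le`). That mean is a finite expression, continuous in the fractions
(`contConv_treeMean`).

The exploration argument is carried by the predicate `Simulates`: a lower bound on means of
nonnegative functions, quantified over everything that may be explored afterwards. A lower bound is
stable under dropping the collisions. Applied to a function and to its negative, suitably shifted
and scaled, it becomes a two-sided estimate. -/

noncomputable section

/-! ### Summing out the spins of a rooted forest. -/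

namespace TreeElimination

variable {V C : Type} [Fintype V] [Fintype C]

/-- A `±1` spin as a real number. -/
def spin (x : ℤˣ) : ℝ := ((x : ℤ) : ℝ)

theorem sum_spin (f : ℝ → ℝ) : ∑ x : ℤˣ, f (spin x) = f 1 + f (-1) := by
  simp [UnitsInt.univ, spin]

open Classical in
-- The map (u, x) ↦ `Function.update u v x` hits every configuration exactly twice, so averaging
-- over the spin at `v` first only doubles both totals.
theorem sum_eq_of_update (v : V) {G G' : (V → ℤˣ) → ℝ}
    (h : ∀ u, ∑ x, G (Function.update u v x) = ∑ x, G' (Function.update u v x)) :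
    ∑ u, G u = ∑ u, G' u := by
  have key : ∀ G : (V → ℤˣ) → ℝ, ∑ u, ∑ x, G (Function.update u v x) = 2 * ∑ u, G u := by
    intro G
    rw [Finset.sum_comm]
    have h1 : ∀ x : ℤˣ, ∑ u : V → ℤˣ, G (Function.update u v x)
        = 2 * ∑ u ∈ Finset.univ.filter (fun u : V → ℤˣ => u v = x), G u := by
      intro x
      have := Finset.sum_fiberwise (Finset.univ : Finset (V → ℤˣ)) (fun u => u v)
        (fun u => G (Function.update u v x))
      rw [← this]
      have h2 : ∀ y : ℤˣ, ∑ u ∈ Finset.univ.filter (fun u : V → ℤˣ => u v = y),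
          G (Function.update u v x) = ∑ u ∈ Finset.univ.filter (fun u : V → ℤˣ => u v = x), G u := by
        intro y
        refine Finset.sum_bij' (fun u _ => Function.update u v x) (fun u _ => Function.update u v y)
          ?_ ?_ ?_ ?_ ?_
        · simp
        · simp
        · intro u hu; simp at hu; subst hu; simp
        · intro u hu; simp at hu; subst hu; simp
        · simp
      simp [h2, UnitsInt.univ]
    simp_rw [h1, ← Finset.mul_sum]
    rw [Finset.sum_fiberwise]
  have := Finset.sum_congr rfl (fun u (_ : u ∈ Finset.univ) => h u)
  rw [key, key] at this
  linarith

variable (q : V → C) (p : C → Option V) (a b : C → ℝ) (h : V → ℝ)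

/-- The factor `1` or `u_v` of the parent `v` of a check node. -/
def parentSpin (u : V → ℤˣ) : Option V → ℝ
  | none => 1
  | some v => spin (u v)

open Classical in
/-- The factor of the check node `k` after the elimination of the variables outside `S`. -/
def factor (S : Finset V) (u : V → ℤˣ) (k : C) : ℝ :=
  if ∀ v, p k = some v → v ∈ S then
    a k + b k * (parentSpin u (p k) *
      ∏ v ∈ Finset.univ.filter (fun v => q v = k), if v ∈ S then spin (u v) else h v)
  else 1

variable {q p a b h}

open Classical in
-- The spin of `v` enters the factor of its parent check `q v` exactly once, or not at all if that
-- factor has already been absorbed. Erasing `v` from `S` then evaluates the same affine function at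
-- the message `h v` instead of at a spin.
theorem factor_affine {S : Finset V} {v : V} (hv : v ∈ S) (hvk : p (q v) ≠ some v) (u : V → ℤˣ) :
    ∃ α β : ℝ, (∀ x, factor q p a b h S (Function.update u v x) (q v) = α + β * spin x) ∧
      ∀ x, factor q p a b h (S.erase v) (Function.update u v x) (q v) = α + β * h v := by
  have hcond : (∀ w, p (q v) = some w → w ∈ S.erase v) ↔ ∀ w, p (q v) = some w → w ∈ S := by
    refine ⟨fun H w hw => Finset.mem_of_mem_erase (H w hw), fun H w hw => ?_⟩
    exact Finset.mem_erase.2 ⟨fun e => hvk (e ▸ hw), H w hw⟩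
  have hps : ∀ x, parentSpin (Function.update u v x) (p (q v)) = parentSpin u (p (q v)) := by
    intro x
    rcases hp : p (q v) with _ | w
    · rfl
    · have : w ≠ v := fun e => hvk (e ▸ hp)
      simp [parentSpin, this]
  by_cases hc : ∀ w, p (q v) = some w → w ∈ S
  · have hmem : v ∈ Finset.univ.filter (fun w => q w = q v) := by simp
    refine ⟨a (q v), b (q v) * (parentSpin u (p (q v)) *
      ∏ w ∈ (Finset.univ.filter (fun w => q w = q v)).erase v, if w ∈ S then spin (u w) else h w),
      fun x => ?_, fun x => ?_⟩
    · rw [factor, if_pos hc, hps, ← Finset.mul_prod_erase _ _ hmem]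
      have : ∏ w ∈ (Finset.univ.filter (fun w => q w = q v)).erase v,
          (if w ∈ S then spin (Function.update u v x w) else h w) =
          ∏ w ∈ (Finset.univ.filter (fun w => q w = q v)).erase v,
          (if w ∈ S then spin (u w) else h w) := by
        refine Finset.prod_congr rfl fun w hw => ?_
        simp [(Finset.mem_erase.1 hw).1]
      rw [this]
      simp only [hv, if_true, Function.update_self]
      ring
    · rw [factor, if_pos (hcond.2 hc), hps, ← Finset.mul_prod_erase _ _ hmem]
      have : ∏ w ∈ (Finset.univ.filter (fun w => q w = q v)).erase v,
          (if w ∈ S.erase v then spin (Function.update u v x w) else h w) =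
          ∏ w ∈ (Finset.univ.filter (fun w => q w = q v)).erase v,
          (if w ∈ S then spin (u w) else h w) := by
        refine Finset.prod_congr rfl fun w hw => ?_
        simp [(Finset.mem_erase.1 hw).1]
      rw [this]
      simp only [Finset.notMem_erase, if_false]
      ring
  · refine ⟨1, 0, fun x => ?_, fun x => ?_⟩
    · rw [factor, if_neg hc]; ring
    · rw [factor, if_neg (fun H => hc (hcond.1 H))]; ring

open Classical in
-- When everything below the child checks of `v` is gone, `v` meets only two terms: its child
-- checks, with product K(1 + hx), and its parent check α + βx. The sum over x = ±1 of K(1 + hx)(α +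
-- βx) is 2K(α + βh), which is K times the corresponding sum with `v` replaced by its message.
theorem sum_factor_erase {K : V → ℝ}
    (hK : ∀ v, ∀ x : ℤˣ, ∏ k ∈ Finset.univ.filter (fun k => p k = some v),
      (a k + b k * (spin x * ∏ w ∈ Finset.univ.filter (fun w => q w = k), h w))
        = K v * (1 + h v * spin x))
    {S : Finset V} {v : V} (hv : v ∈ S) (hmax : ∀ w ∈ S, p (q w) ≠ some v) :
    ∑ u, ∏ k, factor q p a b h S u k = K v * ∑ u, ∏ k, factor q p a b h (S.erase v) u k := by
  rw [Finset.mul_sum]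
  apply sum_eq_of_update v
  intro u
  obtain ⟨α, β, h1, h2⟩ := factor_affine (a := a) (b := b) (h := h) hv (hmax v hv) u
  set R : Finset C := (Finset.univ.filter (fun k => ¬ p k = some v)).erase (q v) with hR
  have hqv : q v ∈ Finset.univ.filter (fun k => ¬ p k = some v) := by simpa using hmax v hv
  have split : ∀ f : C → ℝ, ∏ k, f k =
      (∏ k ∈ Finset.univ.filter (fun k => p k = some v), f k) * (f (q v) * ∏ k ∈ R, f k) := by
    intro f
    rw [← Finset.prod_filter_mul_prod_filter_not Finset.univ (fun k => p k = some v),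
      ← Finset.mul_prod_erase _ _ hqv]
  have hrest : ∀ x y : ℤˣ, ∀ k ∈ R, factor q p a b h (S.erase v) (Function.update u v x) k
      = factor q p a b h S (Function.update u v y) k := by
    intro x y k hk
    simp only [hR, Finset.mem_erase, Finset.mem_filter, Finset.mem_univ, true_and] at hk
    have hcond : (∀ w, p k = some w → w ∈ S.erase v) ↔ ∀ w, p k = some w → w ∈ S := by
      refine ⟨fun H w hw => Finset.mem_of_mem_erase (H w hw), fun H w hw => ?_⟩
      exact Finset.mem_erase.2 ⟨fun e => hk.2 (e ▸ hw), H w hw⟩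
    have hps : parentSpin (Function.update u v x) (p k)
        = parentSpin (Function.update u v y) (p k) := by
      rcases hp : p k with _ | w
      · rfl
      · have : w ≠ v := fun e => hk.2 (e ▸ hp)
        simp [parentSpin, this]
    have hprod : ∏ w ∈ Finset.univ.filter (fun w => q w = k),
          (if w ∈ S.erase v then spin (Function.update u v x w) else h w) =
          ∏ w ∈ Finset.univ.filter (fun w => q w = k),
          (if w ∈ S then spin (Function.update u v y w) else h w) := by
      refine Finset.prod_congr rfl fun w hw => ?_
      have hw' : w ≠ v := fun e => hk.1 (by subst e; simp at hw; exact hw.symm)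
      simp [hw']
    simp only [factor, hcond, hps, hprod]
  have hchild : ∀ x : ℤˣ, ∏ k ∈ Finset.univ.filter (fun k => p k = some v),
      factor q p a b h S (Function.update u v x) k = K v * (1 + h v * spin x) := by
    intro x
    rw [← hK v x]
    refine Finset.prod_congr rfl fun k hk => ?_
    simp only [Finset.mem_filter, Finset.mem_univ, true_and] at hk
    rw [factor, if_pos (by intro w hw; rw [hk] at hw; cases hw; exact hv), hk]
    have : ∏ w ∈ Finset.univ.filter (fun w => q w = k),
          (if w ∈ S then spin (Function.update u v x w) else h w) =
          ∏ w ∈ Finset.univ.filter (fun w => q w = k), h w := by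
      refine Finset.prod_congr rfl fun w hw => ?_
      rw [if_neg]
      intro hwS
      simp only [Finset.mem_filter, Finset.mem_univ, true_and] at hw
      exact hmax w hwS (hw ▸ hk)
    rw [this]
    simp [parentSpin]
  have hchild' : ∀ x : ℤˣ, ∏ k ∈ Finset.univ.filter (fun k => p k = some v),
      factor q p a b h (S.erase v) (Function.update u v x) k = 1 := by
    intro x
    refine Finset.prod_eq_one fun k hk => ?_
    simp only [Finset.mem_filter, Finset.mem_univ, true_and] at hk
    rw [factor, if_neg]
    intro H
    simpa using H v hk
  have e1 : ∀ x : ℤˣ, ∏ k, factor q p a b h S (Function.update u v x) k =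
      K v * (1 + h v * spin x) * ((α + β * spin x) *
        ∏ k ∈ R, factor q p a b h S (Function.update u v 1) k) := by
    intro x
    rw [split, hchild, h1, Finset.prod_congr rfl fun k hk =>
      (hrest 1 x k hk).symm.trans (hrest 1 1 k hk)]
  have e2 : ∀ x : ℤˣ, ∏ k, factor q p a b h (S.erase v) (Function.update u v x) k =
      (α + β * h v) * ∏ k ∈ R, factor q p a b h S (Function.update u v 1) k := by
    intro x
    rw [split, hchild', h2, one_mul, Finset.prod_congr rfl fun k hk => hrest x 1 k hk]
  simp only [e1, e2]
  set T := ∏ k ∈ R, factor q p a b h S (Function.update u v 1) k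
  rw [sum_spin (fun y => K v * (1 + h v * y) * ((α + β * y) * T))]
  simp [UnitsInt.univ]
  ring

open Classical in
/-- Summation over the spins of a rooted forest: if `h` is a fixed point of the message passing
recursion, all variables can be replaced by their messages. -/
theorem sum_prod_eq {K : V → ℝ} (rk : V → ℕ) (hrk : ∀ v w, p (q w) = some v → rk v < rk w)
    (hK : ∀ v, ∀ x : ℤˣ, ∏ k ∈ Finset.univ.filter (fun k => p k = some v),
      (a k + b k * (spin x * ∏ w ∈ Finset.univ.filter (fun w => q w = k), h w))
        = K v * (1 + h v * spin x)) :
    ∑ u : V → ℤˣ, ∏ k, (a k + b k * (parentSpin u (p k) *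
        ∏ v ∈ Finset.univ.filter (fun v => q v = k), spin (u v))) =
      (∏ v, K v) * (2 ^ Fintype.card V * ∏ k ∈ Finset.univ.filter (fun k => p k = none),
        (a k + b k * ∏ v ∈ Finset.univ.filter (fun v => q v = k), h v)) := by
  have main : ∀ n, ∀ S : Finset V, S.card = n → ∑ u, ∏ k, factor q p a b h S u k =
      (∏ v ∈ S, K v) * (2 ^ Fintype.card V * ∏ k ∈ Finset.univ.filter (fun k => p k = none),
        (a k + b k * ∏ v ∈ Finset.univ.filter (fun v => q v = k), h v)) := by
    intro n
    induction n with
    | zero =>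
      intro S hS
      rw [Finset.card_eq_zero] at hS
      subst hS
      have : ∀ u : V → ℤˣ, ∏ k, factor q p a b h ∅ u k =
          ∏ k ∈ Finset.univ.filter (fun k => p k = none),
            (a k + b k * ∏ v ∈ Finset.univ.filter (fun v => q v = k), h v) := by
        intro u
        rw [Finset.prod_filter]
        refine Finset.prod_congr rfl fun k _ => ?_
        rcases hp : p k with _ | w
        · simp [factor, hp, parentSpin]
        · simp [factor, hp]
      simp [this]
    | succ n ih =>
      intro S hS
      -- A variable of maximal rank in `S` has no grandchildren left in `S`, so it can be eliminated
      -- next.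
      obtain ⟨v, hv, hmax⟩ := S.exists_max_image rk (by
        rw [← Finset.card_pos]; omega)
      rw [sum_factor_erase hK hv (fun w hw e => by
        have := hmax w hw; have := hrk v w e; omega), ih _ (by rw [Finset.card_erase_of_mem hv]; omega),
        ← Finset.mul_prod_erase S K hv]
      ring
  rw [← main _ Finset.univ rfl]
  refine Finset.sum_congr rfl fun u _ => Finset.prod_congr rfl fun k _ => ?_
  simp [factor]

end TreeElimination

/-! ### Message passing on the computational tree. -/

namespace TannerGraph

variable {V C E : Type}

section Msg

variable [Fintype E]

open Classical in
/-- The edges at the variable node of `e`, without `e`. -/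
def varNbrs (G : TannerGraph V C E) (e : E) : Finset E :=
  Finset.univ.filter fun e' => G.var e' = G.var e ∧ e' ≠ e

open Classical in
/-- The edges at the check node of `e`, without `e`. -/
def chkNbrs (G : TannerGraph V C E) (e : E) : Finset E :=
  Finset.univ.filter fun e' => G.chk e' = G.chk e ∧ e' ≠ e

theorem mem_varNbrs {G : TannerGraph V C E} {e e' : E} :
    e' ∈ G.varNbrs e ↔ G.var e' = G.var e ∧ e' ≠ e := by
  simp [varNbrs]

theorem mem_chkNbrs {G : TannerGraph V C E} {e e' : E} :
    e' ∈ G.chkNbrs e ↔ G.chk e' = G.chk e ∧ e' ≠ e := by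
  simp [chkNbrs]

open Classical in
/-- The edges at a check node. -/
def chkEdges (G : TannerGraph V C E) (i : C) : Finset E :=
  Finset.univ.filter fun e => G.chk e = i

theorem mem_chkEdges {G : TannerGraph V C E} {e : E} {i : C} :
    e ∈ G.chkEdges i ↔ G.chk e = i := by
  simp [chkEdges]

/-- The message sent along the edge `e` from its variable node to its check node, computed from
the part of the covering tree up to distance `r` from the check node; `t` are the soft channel
observations. -/
def msg (G : TannerGraph V C E) (t : C → ℝ) : ℕ → E → ℝ
  -- For `r = 0` the variable node lies beyond the truncation, so it must contribute the neutral
  -- factor 1. For `r = 1` it is a leaf, whose spin is unbiased.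
  | 0, _ => 1
  | 1, _ => 0
  | r + 2, e =>
    ((∏ e' ∈ G.varNbrs e, (1 + t (G.chk e') * ∏ e'' ∈ G.chkNbrs e', msg G t r e'')) -
      ∏ e' ∈ G.varNbrs e, (1 - t (G.chk e') * ∏ e'' ∈ G.chkNbrs e', msg G t r e'')) /
    ((∏ e' ∈ G.varNbrs e, (1 + t (G.chk e') * ∏ e'' ∈ G.chkNbrs e', msg G t r e'')) +
      ∏ e' ∈ G.varNbrs e, (1 - t (G.chk e') * ∏ e'' ∈ G.chkNbrs e', msg G t r e''))

theorem abs_prod_le_one {ι : Type} {s : Finset ι} {f : ι → ℝ} (h : ∀ i ∈ s, |f i| ≤ 1) :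
    |∏ i ∈ s, f i| ≤ 1 := by
  rw [Finset.abs_prod]
  exact Finset.prod_le_one (fun i _ => abs_nonneg _) h

theorem abs_chk_msg_lt {t s : ℝ} (ht : |t| < 1) (hs : |s| ≤ 1) : |t * s| < 1 := by
  rw [abs_mul]
  exact lt_of_le_of_lt (mul_le_of_le_one_right (abs_nonneg _) hs) ht

theorem abs_msg_le_one (G : TannerGraph V C E) {t : C → ℝ} (ht : ∀ j, |t j| < 1) :
    ∀ r e, |G.msg t r e| ≤ 1
  | 0, _ => by simp [msg]
  | 1, _ => by simp [msg]
  | r + 2, e => by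
    have hs : ∀ e', |t (G.chk e') * ∏ e'' ∈ G.chkNbrs e', G.msg t r e''| < 1 := fun e' =>
      abs_chk_msg_lt (ht _) (abs_prod_le_one fun e'' _ => abs_msg_le_one G ht r e'')
    rw [msg]
    have hA : 0 < ∏ e' ∈ G.varNbrs e, (1 + t (G.chk e') * ∏ e'' ∈ G.chkNbrs e', G.msg t r e'') :=
      Finset.prod_pos fun e' _ => by linarith [(abs_lt.1 (hs e')).1]
    have hB : 0 < ∏ e' ∈ G.varNbrs e, (1 - t (G.chk e') * ∏ e'' ∈ G.chkNbrs e', G.msg t r e'') :=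
      Finset.prod_pos fun e' _ => by linarith [(abs_lt.1 (hs e')).2]
    rw [abs_div, abs_of_pos (add_pos hA hB), div_le_one (add_pos hA hB), abs_le]
    constructor <;> linarith

end Msg

section CompTree

variable [Fintype E] {G : TannerGraph V C E} {i : C} {d : ℕ}

/-- The parent of a variable node of the computational tree. -/
def chkParent (v : G.TreeVar i d) : G.TreeChk i d :=
  ⟨v.1.tail, tail_mem_treeNodes v.2.1, even_length_tail v.2.2⟩

open Classical in
/-- The parent of a check node of the computational tree, if it is not the root. -/
def varParent (k : G.TreeChk i d) : Option (G.TreeVar i d) :=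
  if h : k.1 = [] then none
  else some ⟨k.1.tail, tail_mem_treeNodes k.2.1,
    odd_length_tail h (Nat.not_odd_iff_even.2 k.2.2)⟩

theorem varParent_eq_none {k : G.TreeChk i d} : varParent k = none ↔ k.1 = [] := by
  unfold varParent; split_ifs with h <;> simp [h]

theorem varParent_eq_some {k : G.TreeChk i d} {v : G.TreeVar i d} :
    varParent k = some v ↔ ∃ e, k.1 = e :: v.1 := by
  unfold varParent
  split_ifs with h
  · simp [h]
  · constructor
    · intro hv
      have := Option.some.inj hv
      subst this
      exact ⟨k.1.head h, (List.cons_head_tail h).symm⟩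
    · rintro ⟨e, he⟩
      exact congrArg some (Subtype.ext (by simp [he]))

theorem compTree_chk_of_odd {w : G.TreeEdge i d} (h : Odd w.1.length) :
    ((G.compTree i d).chk w).1 = w.1.tail :=
  congrArg Subtype.val (dif_pos h)

theorem compTree_chk_of_not_odd {w : G.TreeEdge i d} (h : ¬ Odd w.1.length) :
    ((G.compTree i d).chk w).1 = w.1 :=
  congrArg Subtype.val (dif_neg h)

theorem compTree_var_of_odd {w : G.TreeEdge i d} (h : Odd w.1.length) :
    (G.compTree i d).var w = ⟨w.1, w.2.1, h⟩ :=
  dif_pos h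

theorem compTree_var_of_not_odd {w : G.TreeEdge i d} (h : ¬ Odd w.1.length) :
    (G.compTree i d).var w = ⟨w.1.tail, tail_mem_treeNodes w.2.1, odd_length_tail w.2.2 h⟩ :=
  dif_neg h

theorem TreeVar.ne_nil (v : G.TreeVar i d) : v.1 ≠ [] := fun h => by
  have := v.2.2
  rw [h] at this
  simp at this

open Classical in
-- A tree edge is indexed by its lower end. The edges at a check node `k` are therefore its
-- odd-length children together with, unless `k` is the root, the edge `k` itself, which leads to
-- the parent.
theorem codeBit_compTree (u : G.TreeVar i d → ℤˣ) (k : G.TreeChk i d) :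
    (G.compTree i d).codeBit u k = TreeElimination.parentSpin u (varParent k) *
      ∏ v ∈ Finset.univ.filter (fun v => chkParent v = k), TreeElimination.spin (u v) := by
  unfold codeBit
  rw [← Finset.prod_filter_mul_prod_filter_not _ (fun w : G.TreeEdge i d => Odd w.1.length),
    mul_comm]
  congr 1
  · by_cases hk : k.1 = []
    · rw [varParent_eq_none.2 hk]
      refine Finset.prod_eq_one fun w hw => ?_
      simp only [Finset.mem_filter, Finset.mem_univ, true_and] at hw
      obtain ⟨h1, h2⟩ := hw
      exact absurd (by rw [← compTree_chk_of_not_odd h2, h1, hk]) w.2.2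
    · have hodd : ¬ Odd k.1.length := Nat.not_odd_iff_even.2 k.2.2
      let w0 : G.TreeEdge i d := ⟨k.1, k.2.1, hk⟩
      have : (Finset.univ.filter fun w => (G.compTree i d).chk w = k).filter
          (fun w : G.TreeEdge i d => ¬ Odd w.1.length) = {w0} := by
        ext w
        simp only [Finset.mem_filter, Finset.mem_univ, true_and, Finset.mem_singleton]
        constructor
        · rintro ⟨h1, h2⟩
          exact Subtype.ext (by rw [← compTree_chk_of_not_odd h2, h1])
        · rintro rfl
          exact ⟨Subtype.ext (compTree_chk_of_not_odd (w := w0) hodd), hodd⟩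
      rw [this, Finset.prod_singleton, compTree_var_of_not_odd (w := w0) hodd, varParent,
        dif_neg hk]
      rfl
  · refine Finset.prod_bij'
      (fun w hw => (⟨w.1, w.2.1, (Finset.mem_filter.1 hw).2⟩ : G.TreeVar i d))
      (fun v _ => (⟨v.1, v.2.1, v.ne_nil⟩ : G.TreeEdge i d))
      ?_ ?_ ?_ ?_ ?_
    · intro w hw
      simp only [Finset.mem_filter, Finset.mem_univ, true_and] at hw
      obtain ⟨h1, h2⟩ := hw
      refine Finset.mem_filter.2 ⟨Finset.mem_univ _, ?_⟩
      exact Eq.trans (Subtype.ext (compTree_chk_of_odd h2).symm) h1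
    · intro v hv
      simp only [Finset.mem_filter, Finset.mem_univ, true_and] at hv
      refine Finset.mem_filter.2 ⟨Finset.mem_filter.2 ⟨Finset.mem_univ _, ?_⟩, v.2.2⟩
      rw [← hv]
      exact Subtype.ext (compTree_chk_of_odd (w := ⟨v.1, v.2.1, v.ne_nil⟩) v.2.2)
    · intro w _; rfl
    · intro v _; rfl
    · intro w hw
      simp only [Finset.mem_filter, Finset.mem_univ, true_and] at hw
      rw [compTree_var_of_odd hw.2]
      rfl

/-- The message of the variable node `w` in the computational tree. -/
def walkMsg (G : TannerGraph V C E) (t : C → ℝ) (d : ℕ) : List E → ℝ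
  | [] => 0
  | e :: w => G.msg t (d - w.length) e

open Classical in
theorem prod_walkMsg_root (t : C → ℝ) {k : G.TreeChk i d} (hk : k.1 = []) :
    ∏ w ∈ Finset.univ.filter (fun w => chkParent w = k), G.walkMsg t d w.1 =
      ∏ e ∈ G.chkEdges i, G.msg t d e := by
  -- At `d = 0` the root has no children in the tree while the graph still has edges at `i`; the
  -- convention `msg _ 0 = 1` reconciles the two products.
  rcases Nat.eq_zero_or_pos d with rfl | hd
  · rw [Finset.prod_eq_one (s := G.chkEdges i) (by simp [msg])]
    refine Finset.prod_eq_one fun w _ => ?_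
    have h1 := w.2.1.2
    have h2 := w.2.2.pos
    omega
  · have hlen : ∀ w : G.TreeVar i d, chkParent w = k → ∃ e, w.1 = [e] ∧ G.chk e = i := by
      intro w hw
      have h1 : w.1.tail = [] := by rw [← hk, ← hw]; rfl
      rcases hw1 : w.1 with _ | ⟨e, w'⟩
      · exact absurd hw1 w.ne_nil
      · rw [hw1] at h1
        simp only [List.tail_cons] at h1
        subst h1
        have := w.2.1.1
        rw [hw1] at this
        exact ⟨e, rfl, this⟩
    refine Finset.prod_bij (fun w hw => (hlen w (Finset.mem_filter.1 hw).2).choose) ?_ ?_ ?_ ?_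
    · intro w hw
      exact mem_chkEdges.2 (hlen w (Finset.mem_filter.1 hw).2).choose_spec.2
    · intro w hw w' hw' h
      apply Subtype.ext
      rw [(hlen w (Finset.mem_filter.1 hw).2).choose_spec.1,
        (hlen w' (Finset.mem_filter.1 hw').2).choose_spec.1, h]
    · intro e he
      let w : G.TreeVar i d := ⟨[e], ⟨mem_chkEdges.1 he, hd⟩, by simp⟩
      have hw : chkParent w = k := Subtype.ext hk.symm
      refine ⟨w, by simpa using hw, ?_⟩
      have := (hlen w hw).choose_spec.1
      exact (List.cons.inj this).1.symm
    · intro w hw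
      exact congrArg (G.walkMsg t d) (hlen w (Finset.mem_filter.1 hw).2).choose_spec.1

open Classical in
theorem prod_walkMsg_cons (t : C → ℝ) {k : G.TreeChk i d} {e : E} {w₀ : List E}
    (hk : k.1 = e :: w₀) :
    ∏ w ∈ Finset.univ.filter (fun w => chkParent w = k), G.walkMsg t d w.1 =
      ∏ e' ∈ G.chkNbrs e, G.msg t (d - (w₀.length + 1)) e' := by
  have hev : Even (w₀.length + 1) := by have := k.2.2; rw [hk] at this; simpa using this
  have hodd : ¬ Even w₀.length := by rw [Nat.even_add_one] at hev; exact hev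
  have hwalk : G.IsNBWalk i (e :: w₀) := by have := k.2.1.1; rwa [hk] at this
  have hle : w₀.length + 1 ≤ d := by have := k.2.1.2; rwa [hk] at this
  have hlen : ∀ w : G.TreeVar i d, chkParent w = k → ∃ e', w.1 = e' :: e :: w₀ := by
    intro w hw
    have h1 : w.1.tail = e :: w₀ := by rw [← hk, ← hw]; rfl
    rcases hw1 : w.1 with _ | ⟨e', w'⟩
    · rw [hw1] at h1; simp at h1
    · rw [hw1] at h1
      simp only [List.tail_cons] at h1
      exact ⟨e', by rw [h1]⟩
  rcases hle.eq_or_lt with hd | hd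
  · rw [hd, Nat.sub_self]
    rw [Finset.prod_eq_one (s := G.chkNbrs e) (by simp [msg])]
    refine Finset.prod_eq_one fun w hw => ?_
    obtain ⟨e', he'⟩ := hlen w (Finset.mem_filter.1 hw).2
    have h1 := w.2.1.2
    rw [he'] at h1
    simp only [List.length_cons] at h1
    omega
  · refine Finset.prod_bij (fun w hw => (hlen w (Finset.mem_filter.1 hw).2).choose) ?_ ?_ ?_ ?_
    · intro w hw
      have h1 := w.2.1.1
      have h2 := (hlen w (Finset.mem_filter.1 hw).2).choose_spec
      rw [h2] at h1
      obtain ⟨_, hne, h3⟩ := h1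
      rw [if_neg hodd] at h3
      simp only [chkNbrs, Finset.mem_filter, Finset.mem_univ, true_and]
      exact ⟨h3, hne⟩
    · intro w hw w' hw' h
      apply Subtype.ext
      rw [(hlen w (Finset.mem_filter.1 hw).2).choose_spec,
        (hlen w' (Finset.mem_filter.1 hw').2).choose_spec, h]
    · intro e' he'
      simp only [chkNbrs, Finset.mem_filter, Finset.mem_univ, true_and] at he'
      let w : G.TreeVar i d := ⟨e' :: e :: w₀, ⟨⟨hwalk, he'.2, by rw [if_neg hodd]; exact he'.1⟩,
        by simp only [List.length_cons]; omega⟩, by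
          simp only [List.length_cons]; exact hev.add_one⟩
      have hw : chkParent w = k := Subtype.ext hk.symm
      refine ⟨w, by simpa using hw, ?_⟩
      exact (List.cons.inj (hlen w hw).choose_spec).1.symm
    · intro w hw
      exact congrArg (G.walkMsg t d) (hlen w (Finset.mem_filter.1 hw).2).choose_spec

open Classical in
-- Extending a walk by one non-backtracking step at a variable node amounts to choosing an edge in
-- `varNbrs`. The children have length `w₀.length + 2`, hence the case distinction.
theorem prod_varChildren (f : C → ℝ) (g : List E → ℝ) {v : G.TreeVar i d} {e : E} {w₀ : List E}
    (hv : v.1 = e :: w₀) (F : ℝ → ℝ → ℝ) :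
    ∏ k ∈ Finset.univ.filter (fun k => varParent k = some v), F (f (G.treeProj i d k)) (g k.1) =
      if w₀.length + 2 ≤ d then ∏ e' ∈ G.varNbrs e, F (f (G.chk e')) (g (e' :: v.1)) else 1 := by
  have hev : Even w₀.length := by
    have := v.2.2
    rw [hv, List.length_cons, Nat.odd_add_one, Nat.not_odd_iff_even] at this
    exact this
  have hwalk : G.IsNBWalk i (e :: w₀) := by have := v.2.1.1; rwa [hv] at this
  have hlen : ∀ k : G.TreeChk i d, varParent k = some v → ∃ e', k.1 = e' :: v.1 :=
    fun k hk => varParent_eq_some.1 hk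
  split_ifs with hd
  · refine Finset.prod_bij (fun k hk => (hlen k (Finset.mem_filter.1 hk).2).choose) ?_ ?_ ?_ ?_
    · intro k hk
      have h2 := (hlen k (Finset.mem_filter.1 hk).2).choose_spec.trans (congrArg _ hv)
      obtain ⟨_, hne, h3⟩ := (congrArg (G.IsNBWalk i) h2).mp k.2.1.1
      rw [if_pos hev] at h3
      simp only [varNbrs, Finset.mem_filter, Finset.mem_univ, true_and]
      exact ⟨h3, hne⟩
    · intro w hw w' hw' h
      apply Subtype.ext
      rw [(hlen w (Finset.mem_filter.1 hw).2).choose_spec,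
        (hlen w' (Finset.mem_filter.1 hw').2).choose_spec, h]
    · intro e' he'
      simp only [varNbrs, Finset.mem_filter, Finset.mem_univ, true_and] at he'
      let k : G.TreeChk i d := ⟨e' :: e :: w₀, ⟨⟨hwalk, he'.2, by rw [if_pos hev]; exact he'.1⟩,
        by simp only [List.length_cons]; omega⟩, by
          simp only [List.length_cons]; exact hev.add even_two⟩
      have hk : varParent k = some v := varParent_eq_some.2 ⟨e', by rw [hv]⟩
      refine ⟨k, by simpa using hk, ?_⟩
      exact (List.cons.inj (hlen k hk).choose_spec).1.symm
    · intro k hk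
      have h2 := (hlen k (Finset.mem_filter.1 hk).2).choose_spec
      rw [treeProj]
      conv_lhs => rw [h2]
      rfl
  · refine Finset.prod_eq_one fun k hk => ?_
    obtain ⟨e', he'⟩ := hlen k (Finset.mem_filter.1 hk).2
    have h1 := k.2.1.2
    rw [he', hv] at h1
    simp only [List.length_cons] at h1
    omega

theorem exp_mul_spin (l : ℝ) {x : ℝ} (hx : x = 1 ∨ x = -1) :
    Real.exp (l * x) = Real.cosh l + Real.sinh l * x := by
  rcases hx with rfl | rfl
  · rw [mul_one, mul_one, Real.cosh_add_sinh]
  · rw [mul_neg_one, mul_neg_one, ← sub_eq_add_neg, Real.cosh_sub_sinh]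

theorem spin_cases (x : ℤˣ) : TreeElimination.spin x = 1 ∨ TreeElimination.spin x = -1 := by
  rcases Int.units_eq_one_or x with rfl | rfl <;> simp [TreeElimination.spin]

theorem codeBit_cases {V C E : Type} [Fintype E] (G : TannerGraph V C E)
    (u : V → ℤˣ) (j : C) : G.codeBit u j = 1 ∨ G.codeBit u j = -1 := by
  unfold codeBit
  refine Finset.prod_induction _ (fun x : ℝ => x = 1 ∨ x = -1) ?_ (Or.inl rfl)
    fun e _ => spin_cases (u (G.var e))
  rintro a b (rfl | rfl) (rfl | rfl) <;> simp

open Classical in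
-- The weight of the root is left as an arbitrary affine function of its code-bit, and `K` does not
-- depend on it. Numerator and denominator of the Gibbs average are then two instances with the same
-- `K`, which cancels.
theorem sum_codeBit_compTree (l : C → ℝ) :
    ∃ K : ℝ, K ≠ 0 ∧ ∀ α β : ℝ, ∑ u : G.TreeVar i d → ℤˣ,
      ∏ k, (if k.1 = [] then α + β * (G.compTree i d).codeBit u k
        else Real.exp (l (G.treeProj i d k) * (G.compTree i d).codeBit u k)) =
      K * (α + β * ∏ e ∈ G.chkEdges i,
        G.msg (fun j => Real.tanh (l j)) d e) := by
  set t : C → ℝ := fun j => Real.tanh (l j) with ht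
  have ht1 : ∀ j, |t j| < 1 := fun j => Real.abs_tanh_lt_one _
  let A : G.TreeVar i d → ℝ → ℝ := fun v x =>
    ∏ k ∈ Finset.univ.filter (fun k => varParent k = some v),
      (1 + x * (t (G.treeProj i d k) *
        ∏ w ∈ Finset.univ.filter (fun w => chkParent w = k), G.walkMsg t d w.1))
  -- As a function of a single spin, the product of the child factors is affine. `K v` is its mean
  -- over the spin, and the message is the ratio of its slope to its mean.
  let K : G.TreeVar i d → ℝ := fun v =>
    (∏ k ∈ Finset.univ.filter (fun k => varParent k = some v), Real.cosh (l (G.treeProj i d k))) *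
      ((A v 1 + A v (-1)) / 2)
  have habs : ∀ k : G.TreeChk i d, |t (G.treeProj i d k) *
        ∏ w ∈ Finset.univ.filter (fun w => chkParent w = k), G.walkMsg t d w.1| < 1 := by
    intro k
    refine abs_chk_msg_lt (ht1 _) (abs_prod_le_one fun w _ => ?_)
    rcases w.1 with _ | ⟨e, w'⟩
    · simp [walkMsg]
    · exact abs_msg_le_one G ht1 _ _
  have hA1 : ∀ v, 0 < A v 1 := fun v => Finset.prod_pos fun k _ => by
    linarith [(abs_lt.1 (habs k)).1]
  have hA2 : ∀ v, 0 < A v (-1) := fun v => Finset.prod_pos fun k _ => by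
    linarith [(abs_lt.1 (habs k)).2]
  have hmsg : ∀ v : G.TreeVar i d, G.walkMsg t d v.1 * (A v 1 + A v (-1)) = A v 1 - A v (-1) := by
    intro v
    rcases hv : v.1 with _ | ⟨e, w₀⟩
    · exact absurd hv v.ne_nil
    have hA : ∀ x, A v x = if w₀.length + 2 ≤ d then ∏ e' ∈ G.varNbrs e, (1 + x * (t (G.chk e') *
        ∏ e'' ∈ G.chkNbrs e', G.msg t (d - (w₀.length + 2)) e'')) else 1 := by
      intro x
      let g : List E → ℝ := fun w => match w with
        | [] => 0
        | e' :: w' => ∏ e'' ∈ G.chkNbrs e', G.msg t (d - (w'.length + 1)) e''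
      have h1 := prod_varChildren (G := G) (i := i) (d := d) t g hv
        (fun a b => 1 + x * (a * b))
      simp only [g, hv, List.length_cons] at h1
      rw [← h1]
      refine Finset.prod_congr rfl fun k hk => ?_
      obtain ⟨e', he'⟩ := varParent_eq_some.1 (Finset.mem_filter.1 hk).2
      rw [prod_walkMsg_cons t he']
      simp only [he']
    have hpos := add_pos (hA1 v) (hA2 v)
    rw [hA, hA] at *
    split_ifs with hd
    · obtain ⟨r, hr⟩ : ∃ r, d - w₀.length = r + 2 := ⟨d - (w₀.length + 2), by omega⟩
      have hr' : d - (w₀.length + 2) = r := by omega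
      rw [if_pos hd, if_pos hd] at hpos
      rw [hr'] at hpos ⊢
      simp only [one_mul, neg_one_mul, ← sub_eq_add_neg] at hpos ⊢
      simp only [walkMsg]
      rw [hr, msg, div_mul_cancel₀ _ hpos.ne']
    -- A leaf of the tree: the products are empty and the message is `msg` at `r = 1`, that is, 0.
    · have h1 := v.2.1.2
      rw [hv, List.length_cons] at h1
      have : d - w₀.length = 1 := by omega
      simp [walkMsg, this, msg]
  have hK0 : ∏ v, K v ≠ 0 := Finset.prod_ne_zero_iff.2 fun v _ =>
    mul_ne_zero (Finset.prod_ne_zero_iff.2 fun k _ => (Real.cosh_pos _).ne')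
      (by linarith [hA1 v, hA2 v] : (0:ℝ) < (A v 1 + A v (-1)) / 2).ne'
  refine ⟨(∏ v, K v) * 2 ^ Fintype.card (G.TreeVar i d), mul_ne_zero hK0 (by positivity), ?_⟩
  intro α β
  have key := TreeElimination.sum_prod_eq (q := chkParent (G := G) (i := i) (d := d))
    (p := varParent) (a := fun k => if k.1 = [] then α else Real.cosh (l (G.treeProj i d k)))
    (b := fun k => if k.1 = [] then β else Real.sinh (l (G.treeProj i d k)))
    (h := fun v => G.walkMsg t d v.1) (K := K) (fun v => v.1.length) ?_ ?_
  · have hroot : Finset.univ.filter (fun k : G.TreeChk i d => varParent k = none)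
        = {G.treeRoot i d} := by
      ext k
      simp only [Finset.mem_filter, Finset.mem_univ, true_and, varParent_eq_none,
        Finset.mem_singleton]
      exact ⟨fun h => Subtype.ext h, fun h => by rw [h]; rfl⟩
    have hr : (G.treeRoot i d).1 = [] := rfl
    rw [hroot, Finset.prod_singleton, prod_walkMsg_root t hr, if_pos hr, if_pos hr,
      ← mul_assoc] at key
    rw [← key]
    refine Finset.sum_congr rfl fun u _ => Finset.prod_congr rfl fun k _ => ?_
    rw [← codeBit_compTree]
    split_ifs
    · rfl
    · exact exp_mul_spin _ (codeBit_cases _ _ _)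
  · intro v w hvw
    obtain ⟨e, he⟩ := varParent_eq_some.1 hvw
    have h1 : w.1.tail = e :: v.1 := he
    have h2 := congrArg List.length h1
    simp only [List.length_tail, List.length_cons] at h2
    show v.1.length < w.1.length
    omega
  · intro v x
    have h1 : ∏ k ∈ Finset.univ.filter (fun k => varParent k = some v),
        ((if k.1 = [] then α else Real.cosh (l (G.treeProj i d k))) +
          (if k.1 = [] then β else Real.sinh (l (G.treeProj i d k))) * (TreeElimination.spin x *
            ∏ w ∈ Finset.univ.filter (fun w => chkParent w = k), G.walkMsg t d w.1)) =
        (∏ k ∈ Finset.univ.filter (fun k => varParent k = some v),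
          Real.cosh (l (G.treeProj i d k))) * A v (TreeElimination.spin x) := by
      rw [← Finset.prod_mul_distrib]
      refine Finset.prod_congr rfl fun k hk => ?_
      have hk' : k.1 ≠ [] := fun h => by
        have := (Finset.mem_filter.1 hk).2
        rw [varParent_eq_none.2 h] at this
        cases this
      rw [if_neg hk', if_neg hk']
      simp only [ht, Real.tanh_eq_sinh_div_cosh]
      have := (Real.cosh_pos (l (G.treeProj i d k))).ne'
      field_simp
    rw [h1]
    simp only [K]
    rw [mul_assoc]
    congr 1
    have := hmsg v
    rcases spin_cases x with h | h <;> rw [h] <;> linarith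

open Classical in
/-- The extrinsic BP estimate is computed by message passing. -/
theorem extrinsicSoftBit_eq_prod_msg (G : TannerGraph V C E) (d : ℕ) (l : C → ℝ) (i : C) :
    G.extrinsicSoftBit d l i = ∏ e ∈ G.chkEdges i,
      G.msg (fun j => Real.tanh (Function.update l i 0 j)) d e := by
  obtain ⟨K, hK, h⟩ := sum_codeBit_compTree (G := G) (i := i) (d := d) (Function.update l i 0)
  -- The observation at the root is erased, so its Gibbs weight is 1 and can be traded for α + βx.
  have hroot : Function.update l i 0 (G.treeProj i d (G.treeRoot i d)) = 0 := by
    show Function.update l i 0 i = 0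
    simp
  have hsplit : ∀ f : G.TreeChk i d → ℝ, ∏ k, f k =
      f (G.treeRoot i d) * ∏ k ∈ Finset.univ.erase (G.treeRoot i d), f k :=
    fun f => (Finset.mul_prod_erase _ _ (Finset.mem_univ _)).symm
  have hne : ∀ k ∈ Finset.univ.erase (G.treeRoot i d), k.1 ≠ [] := fun k hk h =>
    (Finset.mem_erase.1 hk).1 (Subtype.ext h)
  have hr : (G.treeRoot i d).1 = [] := rfl
  have e1 : ∀ (α β : ℝ) (u : G.TreeVar i d → ℤˣ), (α + β * (G.compTree i d).codeBit u
      (G.treeRoot i d)) * (G.compTree i d).gibbsWeight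
        (fun k => Function.update l i 0 (G.treeProj i d k)) u =
      ∏ k, (if k.1 = [] then α + β * (G.compTree i d).codeBit u k
        else Real.exp (Function.update l i 0 (G.treeProj i d k) *
          (G.compTree i d).codeBit u k)) := by
    intro α β u
    rw [gibbsWeight, hsplit, hsplit (fun k => if k.1 = [] then _ else _), hroot, if_pos hr, zero_mul,
      Real.exp_zero, one_mul]
    congr 1
    exact Finset.prod_congr rfl fun k hk => by rw [if_neg (hne k hk)]
  unfold extrinsicSoftBit softBit bracket
  have hnum := h 0 1
  have hden := h 1 0
  rw [← Finset.sum_congr rfl fun u _ => e1 _ _ u] at hnum hden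
  simp only [zero_add, one_mul, zero_mul, add_zero, mul_one] at hnum hden
  rw [hnum, hden, mul_div_cancel_left₀ _ hK]

end CompTree

end TannerGraph

/-! ### Contraction of the messages at high noise. -/

namespace TannerGraph

/-- The factors are replaced one at a time, each replacement costing `δ` times a product of the
others. The bound is in terms of `n` rather than the cardinality so as to be uniform over nodes of
bounded degree. -/
theorem abs_prod_sub_prod_le {ι : Type} {s : Finset ι} {f g : ι → ℝ} {M δ : ℝ} {n : ℕ}
    (hM : 1 ≤ M) (hδ : 0 ≤ δ) (hf : ∀ i ∈ s, |f i| ≤ M) (hg : ∀ i ∈ s, |g i| ≤ M)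
    (hfg : ∀ i ∈ s, |f i - g i| ≤ δ) (hn : s.card ≤ n) :
    |∏ i ∈ s, f i - ∏ i ∈ s, g i| ≤ M ^ n * (n * δ) := by
  classical
  have key : |∏ i ∈ s, f i - ∏ i ∈ s, g i| ≤ M ^ s.card * (s.card * δ) := by
    clear hn
    induction s using Finset.induction_on with
    | empty => simp
    | insert a s ha ih =>
      rw [Finset.prod_insert ha, Finset.prod_insert ha, Finset.card_insert_of_notMem ha]
      have ih' := ih (fun i hi => hf i (Finset.mem_insert_of_mem hi))
        (fun i hi => hg i (Finset.mem_insert_of_mem hi))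
        (fun i hi => hfg i (Finset.mem_insert_of_mem hi))
      have h1 := hf a (Finset.mem_insert_self _ _)
      have h2 := hfg a (Finset.mem_insert_self _ _)
      have h3 : |∏ i ∈ s, g i| ≤ M ^ s.card := by
        rw [Finset.abs_prod]
        rw [← Finset.prod_const]
        exact Finset.prod_le_prod (fun i _ => abs_nonneg _)
          fun i hi => hg i (Finset.mem_insert_of_mem hi)
      have hMs : 1 ≤ M ^ s.card := one_le_pow₀ hM
      have e : f a * ∏ i ∈ s, f i - g a * ∏ i ∈ s, g i =
        f a * (∏ i ∈ s, f i - ∏ i ∈ s, g i) + (f a - g a) * ∏ i ∈ s, g i := by ring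
      rw [e]
      refine (abs_add_le _ _).trans ?_
      rw [abs_mul, abs_mul]
      have h4 : |f a| * |∏ i ∈ s, f i - ∏ i ∈ s, g i| ≤ M * (M ^ s.card * (s.card * δ)) :=
        mul_le_mul h1 ih' (abs_nonneg _) (by linarith)
      have h5 : |f a - g a| * |∏ i ∈ s, g i| ≤ δ * M ^ s.card :=
        mul_le_mul h2 h3 (abs_nonneg _) hδ
      have h6 : δ * M ^ s.card ≤ M * (M ^ s.card * δ) := by
        have : 0 ≤ M ^ s.card * δ := by positivity
        nlinarith
      push_cast
      rw [pow_succ]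
      nlinarith
  have hc : (s.card : ℝ) ≤ n := by exact_mod_cast hn
  refine key.trans (mul_le_mul (pow_le_pow_right₀ hM hn) ?_ (by positivity) (by positivity))
  exact mul_le_mul_of_nonneg_right hc hδ

/-- Over a common denominator the numerator is 2((A - A')B' - (B - B')A'), which is at most 2η(A' +
B'). The factor A' + B' cancels, so a quantitative lower bound is needed on one side only. -/
theorem abs_ratio_sub_ratio_le {A B A' B' c η : ℝ} (hc : 0 < c) (hA : c ≤ A) (hB : c ≤ B)
    (hA' : 0 < A') (hB' : 0 < B') (h1 : |A - A'| ≤ η) (h2 : |B - B'| ≤ η) :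
    |(A - B) / (A + B) - (A' - B') / (A' + B')| ≤ 2 * η / c := by
  have hAB : 0 < A + B := by linarith
  have hAB' : 0 < A' + B' := by linarith
  have e : (A - B) / (A + B) - (A' - B') / (A' + B') =
      2 * ((A - A') * B' - (B - B') * A') / ((A + B) * (A' + B')) := by
    field_simp
    ring
  have hη : 0 ≤ η := (abs_nonneg _).trans h1
  rw [e, abs_div, abs_of_pos (mul_pos hAB hAB'), div_le_div_iff₀ (mul_pos hAB hAB') hc, abs_mul,
    abs_of_pos (by norm_num : (0:ℝ) < 2)]
  have h3 : |(A - A') * B' - (B - B') * A'| ≤ η * (A' + B') := by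
    refine (abs_sub _ _).trans ?_
    rw [abs_mul, abs_mul, abs_of_pos hA', abs_of_pos hB']
    nlinarith
  have h4 : c ≤ A + B := by linarith
  calc 2 * |(A - A') * B' - (B - B') * A'| * c ≤ 2 * (η * (A' + B')) * c := by gcongr
    _ ≤ 2 * (η * (A' + B')) * (A + B) := by gcongr
    _ = 2 * η * ((A + B) * (A' + B')) := by ring

variable {V C E : Type} [Fintype E] (G : TannerGraph V C E)

/-- One round of message passing halves the discrepancy. If the inputs differ by δ, the check
messages differ by τKδ, and the products over the variable node by (3/2)^L·L·τKδ. The denominators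
are bounded below through (1/2)^L, which gives at most 2·3^L·L·K·τ·δ ≤ δ/2. The summand 2 in the
threshold ensures τ ≤ 1/2, so that all factors lie in [1/2, 3/2]. A round consumes two levels of the
tree, hence `2 * j`. -/
theorem abs_msg_sub_msg_le {L K : ℕ} {t : C → ℝ}
    (hL : ∀ e, (G.varNbrs e).card ≤ L) (hK : ∀ e, (G.chkNbrs e).card ≤ K)
    (ht : ∀ j, |t j| ≤ 1 / (4 * 3 ^ L * L * K + 2)) :
    ∀ j r r', 2 * j ≤ r → 2 * j ≤ r' → ∀ e, |G.msg t r e - G.msg t r' e| ≤ 2 * (1 / 2) ^ j := by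
  set τ : ℝ := 1 / (4 * 3 ^ L * L * K + 2) with hτ
  have hden : (2:ℝ) ≤ 4 * 3 ^ L * L * K + 2 := by
    have : (0:ℝ) ≤ 4 * 3 ^ L * L * K := by positivity
    linarith
  have hτ0 : 0 ≤ τ := by positivity
  have hτ1 : τ ≤ 1 / 2 := one_div_le_one_div_of_le two_pos hden
  have hτ2 : 4 * 3 ^ L * L * K * τ ≤ 1 := by
    rw [hτ, mul_one_div]
    exact div_le_one_of_le₀ (by linarith) (by linarith)
  have ht1 : ∀ j, |t j| < 1 := fun j => by linarith [ht j]
  intro j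
  induction j with
  | zero =>
    intro r r' _ _ e
    have h1 := G.abs_msg_le_one ht1 r e
    have h2 := G.abs_msg_le_one ht1 r' e
    refine (abs_sub _ _).trans ?_
    norm_num
    linarith
  | succ j ih =>
    intro r r' hr hr' e
    obtain ⟨r, rfl⟩ : ∃ s, r = s + 2 := ⟨r - 2, by omega⟩
    obtain ⟨r', rfl⟩ : ∃ s, r' = s + 2 := ⟨r' - 2, by omega⟩
    set δ : ℝ := 2 * (1 / 2) ^ j with hδ
    have hδ0 : 0 ≤ δ := by positivity
    let s : ℕ → E → ℝ := fun r e' => t (G.chk e') * ∏ e'' ∈ G.chkNbrs e', G.msg t r e''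
    have hs : ∀ r e', |s r e'| ≤ 1 / 2 := by
      intro r e'
      simp only [s, abs_mul]
      have h1 : |∏ e'' ∈ G.chkNbrs e', G.msg t r e''| ≤ 1 :=
        abs_prod_le_one fun e'' _ => G.abs_msg_le_one ht1 r e''
      calc _ ≤ |t (G.chk e')| * 1 := by gcongr
        _ ≤ 1 / 2 := by linarith [ht (G.chk e')]
    have hsd : ∀ e', |s r e' - s r' e'| ≤ τ * (K * δ) := by
      intro e'
      simp only [s, ← mul_sub, abs_mul]
      refine mul_le_mul (ht _) ?_ (abs_nonneg _) hτ0
      have := abs_prod_sub_prod_le (s := G.chkNbrs e') (f := G.msg t r) (g := G.msg t r')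
        le_rfl hδ0 (fun e'' _ => G.abs_msg_le_one ht1 r e'')
        (fun e'' _ => G.abs_msg_le_one ht1 r' e'')
        (fun e'' _ => ih r r' (by omega) (by omega) e'') (hK e')
      simpa using this
    have hA : |∏ e' ∈ G.varNbrs e, (1 + s r e') - ∏ e' ∈ G.varNbrs e, (1 + s r' e')| ≤
        (3 / 2) ^ L * (L * (τ * (K * δ))) := by
      refine abs_prod_sub_prod_le (by norm_num) (by positivity) ?_ ?_ ?_ (hL e)
      · intro e' _; have := abs_le.1 (hs r e'); rw [abs_le]; constructor <;> linarith
      · intro e' _; have := abs_le.1 (hs r' e'); rw [abs_le]; constructor <;> linarith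
      · intro e' _; rw [add_sub_add_left_eq_sub]; exact hsd e'
    have hB : |∏ e' ∈ G.varNbrs e, (1 - s r e') - ∏ e' ∈ G.varNbrs e, (1 - s r' e')| ≤
        (3 / 2) ^ L * (L * (τ * (K * δ))) := by
      refine abs_prod_sub_prod_le (by norm_num) (by positivity) ?_ ?_ ?_ (hL e)
      · intro e' _; have := abs_le.1 (hs r e'); rw [abs_le]; constructor <;> linarith
      · intro e' _; have := abs_le.1 (hs r' e'); rw [abs_le]; constructor <;> linarith
      · intro e' _; rw [sub_sub_sub_cancel_left, abs_sub_comm]; exact hsd e'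
    have hlow : ∀ f : E → ℝ, (∀ e', 1 / 2 ≤ f e') → (1 / 2 : ℝ) ^ L ≤ ∏ e' ∈ G.varNbrs e, f e' := by
      intro f hf
      calc (1 / 2 : ℝ) ^ L ≤ (1 / 2) ^ (G.varNbrs e).card :=
            pow_le_pow_of_le_one (by norm_num) (by norm_num) (hL e)
        _ = ∏ e' ∈ G.varNbrs e, (1 / 2 : ℝ) := by simp
        _ ≤ _ := Finset.prod_le_prod (fun _ _ => by norm_num) fun e' _ => hf e'
    have h2L : (0:ℝ) < (1 / 2) ^ L := by positivity
    have hp : ∀ r e', 1 / 2 ≤ 1 + s r e' := fun r e' => by linarith [(abs_le.1 (hs r e')).1]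
    have hm : ∀ r e', 1 / 2 ≤ 1 - s r e' := fun r e' => by linarith [(abs_le.1 (hs r e')).2]
    have main := abs_ratio_sub_ratio_le h2L (hlow _ (hp r)) (hlow _ (hm r))
      (h2L.trans_le (hlow _ (hp r'))) (h2L.trans_le (hlow _ (hm r'))) hA hB
    rw [msg, msg]
    refine main.trans ?_
    have e1 : 2 * ((3 / 2) ^ L * (L * (τ * (K * δ)))) / (1 / 2 : ℝ) ^ L =
        (4 * 3 ^ L * L * K * τ) * (δ / 2) := by
      rw [div_pow, div_pow, one_pow]
      field_simp
      ring
    rw [e1, pow_succ]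
    calc (4 * 3 ^ L * L * K * τ) * (δ / 2) ≤ 1 * (δ / 2) := by gcongr
      _ = 2 * ((1 / 2) ^ j * (1 / 2)) := by rw [hδ]; ring

/-- At high noise, the extrinsic BP estimates converge geometrically in the depth of the
computational tree, uniformly over all graphs of bounded degree. -/
theorem abs_extrinsicSoftBit_sub_le {L K : ℕ} {l : C → ℝ}
    (hL : ∀ e, (G.varNbrs e).card ≤ L) (hK : ∀ e, (G.chkNbrs e).card ≤ K)
    (hl : ∀ j, |Real.tanh (l j)| ≤ 1 / (4 * 3 ^ L * L * K + 2)) {i : C} {n : ℕ}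
    (hn : (G.chkEdges i).card ≤ n) {j d d' : ℕ}
    (hd : 2 * j ≤ d) (hd' : 2 * j ≤ d') :
    |G.extrinsicSoftBit d l i - G.extrinsicSoftBit d' l i| ≤ n * (2 * (1 / 2) ^ j) := by
  classical
  rw [extrinsicSoftBit_eq_prod_msg, extrinsicSoftBit_eq_prod_msg]
  have ht : ∀ j, |Real.tanh (Function.update l i 0 j)| ≤ 1 / (4 * 3 ^ L * L * K + 2) := by
    intro j
    by_cases h : j = i
    · subst h
      simp only [Function.update_self, Real.tanh_zero, abs_zero]
      positivity
    · rw [Function.update_of_ne h]; exact hl j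
  have ht1 : ∀ j, |Real.tanh (Function.update l i 0 j)| < 1 := fun j => Real.abs_tanh_lt_one _
  have := abs_prod_sub_prod_le (s := G.chkEdges i) le_rfl
    (by positivity) (fun e _ => G.abs_msg_le_one ht1 d e) (fun e _ => G.abs_msg_le_one ht1 d' e)
    (fun e _ => G.abs_msg_sub_msg_le hL hK ht j d d' hd hd' e) hn
  simpa using this

theorem abs_extrinsicSoftBit_le_one (d : ℕ) (l : C → ℝ) (i : C) :
    |G.extrinsicSoftBit d l i| ≤ 1 := by
  rw [extrinsicSoftBit_eq_prod_msg]
  exact abs_prod_le_one fun e _ => G.abs_msg_le_one (fun j => Real.abs_tanh_lt_one _) d e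

end TannerGraph

/-! ### The GEXIT kernel of the binary symmetric channel. -/

theorem tanh_half_log {a : ℝ} (ha : 0 < a) : Real.tanh (Real.log a / 2) = (a - 1) / (a + 1) := by
  have h1 : Real.exp (Real.log a / 2) * Real.exp (Real.log a / 2) = a := by
    rw [← Real.exp_add, add_halves, Real.exp_log ha]
  have h2 : Real.exp (-(Real.log a / 2)) * Real.exp (Real.log a / 2) = 1 := by
    rw [← Real.exp_add]; simp
  have h3 := Real.exp_pos (Real.log a / 2)
  rw [Real.tanh_eq_sinh_div_cosh, Real.sinh_eq, Real.cosh_eq]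
  have h4 := Real.exp_pos (-(Real.log a / 2))
  rw [div_div_div_cancel_right₀ two_ne_zero, div_eq_div_iff (by positivity) (by positivity)]
  set y := Real.exp (Real.log a / 2)
  set z := Real.exp (-(Real.log a / 2))
  linear_combination (-(2 * y)) * h2 + (2 * z) * h1

theorem tanh_bscLLR_false {ε : ℝ} (h0 : 0 < ε) (h1 : ε < 1) :
    Real.tanh (bscLLR ε false) = 1 - 2 * ε := by
  have : 0 < 1 - ε := by linarith
  rw [bscLLR, if_neg (by simp), tanh_half_log (by positivity)]
  field_simp
  ring

theorem tanh_bscLLR_true {ε : ℝ} (h0 : 0 < ε) (h1 : ε < 1) :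
    Real.tanh (bscLLR ε true) = -(1 - 2 * ε) := by
  have : 0 < 1 - ε := by linarith
  rw [bscLLR, if_pos rfl, tanh_half_log (by positivity)]
  field_simp
  ring

/-- The integral against `dc_ε/dε` in the GEXIT function, for a given extrinsic soft bit `x`. -/
def gexitKernel (ε x : ℝ) : ℝ :=
  bscDerivMean ε fun l => Real.log ((1 + x * Real.tanh l) / (1 + Real.tanh l))

/-- The closed form of `gexitKernel`. -/
def gexitKernelFormula (ε x : ℝ) : ℝ :=
  -(Real.log (1 + x * (1 - 2 * ε)) - Real.log (2 - 2 * ε)) +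
    (1 - ε) * (-(2 * x) / (1 + x * (1 - 2 * ε)) + 2 / (2 - 2 * ε)) +
  (Real.log (1 - x * (1 - 2 * ε)) - Real.log (2 * ε) +
    ε * (2 * x / (1 - x * (1 - 2 * ε)) - 2 / (2 * ε)))

theorem abs_mul_lt_one_of_bsc {ε x : ℝ} (h0 : 0 < ε) (h1 : ε < 1) (hx : |x| ≤ 1) :
    |x * (1 - 2 * ε)| < 1 := by
  rw [abs_mul]
  have : |1 - 2 * ε| < 1 := by rw [abs_lt]; constructor <;> linarith
  exact (mul_le_of_le_one_left (abs_nonneg _) hx).trans_lt this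

/-- The test function is fixed, but both the weights and the atoms of the law move with the noise.
The hyperbolic tangents of the atoms are ±(1 - 2e), so near `ε` the mean is an elementary function
of e; `|x| ≤ 1` keeps the arguments of the logarithms positive. -/
theorem hasDerivAt_bscMean_log {ε x : ℝ} (h0 : 0 < ε) (h1 : ε < 1) (hx : |x| ≤ 1) :
    HasDerivAt (fun e => bscMean e fun l => Real.log ((1 + x * Real.tanh l) / (1 + Real.tanh l)))
      (gexitKernelFormula ε x) ε := by
  have hform : (fun e => bscMean e fun l =>
      Real.log ((1 + x * Real.tanh l) / (1 + Real.tanh l))) =ᶠ[𝓝 ε]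
      fun e => (1 - e) * (Real.log (1 + x * (1 - 2 * e)) - Real.log (2 - 2 * e)) +
        e * (Real.log (1 - x * (1 - 2 * e)) - Real.log (2 * e)) := by
    filter_upwards [Ioo_mem_nhds h0 h1] with e he
    have hlt := abs_lt.1 (abs_mul_lt_one_of_bsc he.1 he.2 hx)
    simp only [bscMean, Fintype.sum_bool, tanh_bscLLR_true he.1 he.2,
      tanh_bscLLR_false he.1 he.2, bscProb, if_true]
    rw [show (1:ℝ) + (1 - 2 * e) = 2 - 2 * e by ring, show (1:ℝ) + -(1 - 2 * e) = 2 * e by ring,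
      mul_neg, ← sub_eq_add_neg, Real.log_div (by linarith) (by linarith [he.1]),
      Real.log_div (by linarith) (by linarith [he.2])]
    simp
    ring
  refine HasDerivAt.congr_of_eventuallyEq ?_ hform
  have hlt := abs_lt.1 (abs_mul_lt_one_of_bsc h0 h1 hx)
  have d0 : HasDerivAt (fun e : ℝ => e) 1 ε := hasDerivAt_id ε
  have d1 : HasDerivAt (fun e : ℝ => 1 + x * (1 - 2 * e)) (-(2 * x)) ε := by
    exact HasDerivAt.congr_deriv ((((d0.const_mul 2).const_sub 1).const_mul x).const_add 1) (by ring)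
  have d2 : HasDerivAt (fun e : ℝ => 1 - x * (1 - 2 * e)) (2 * x) ε := by
    exact HasDerivAt.congr_deriv ((((d0.const_mul 2).const_sub 1).const_mul x).const_sub 1) (by ring)
  have d3 : HasDerivAt (fun e : ℝ => 2 - 2 * e) (-2) ε := by
    exact HasDerivAt.congr_deriv ((d0.const_mul 2).const_sub 2) (by ring)
  have d4 : HasDerivAt (fun e : ℝ => 2 * e) 2 ε := by
    exact HasDerivAt.congr_deriv (d0.const_mul 2) (by ring)
  have l1 := d1.log (by linarith)
  have l2 := d2.log (by linarith)
  have l3 := d3.log (by linarith)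
  have l4 := d4.log (by linarith)
  have d5 : HasDerivAt (fun e : ℝ => 1 - e) (-1) ε := by
    exact d0.const_sub 1
  have := (d5.mul (l1.sub l3)).add (d0.mul (l2.sub l4))
  refine HasDerivAt.congr_deriv this ?_
  simp only [gexitKernelFormula, Pi.sub_apply]
  ring

theorem gexitKernel_eq {ε x : ℝ} (h0 : 0 < ε) (h1 : ε < 1) (hx : |x| ≤ 1) :
    gexitKernel ε x = gexitKernelFormula ε x :=
  (hasDerivAt_bscMean_log h0 h1 hx).deriv

theorem continuousOn_gexitKernel {ε : ℝ} (h0 : 0 < ε) (h1 : ε < 1) :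
    ContinuousOn (gexitKernel ε) (Set.Icc (-1) 1) := by
  have : ContinuousOn (gexitKernelFormula ε) (Set.Icc (-1) 1) := by
    intro x hx
    have hlt := abs_lt.1 (abs_mul_lt_one_of_bsc h0 h1 (abs_le.2 hx))
    apply ContinuousAt.continuousWithinAt
    have hp : 1 + x * (1 - 2 * ε) ≠ 0 := by linarith
    have hm : 1 - x * (1 - 2 * ε) ≠ 0 := by linarith
    unfold gexitKernelFormula
    fun_prop (disch := assumption)
  exact this.congr fun x hx => gexitKernel_eq h0 h1 (abs_le.2 hx)

/-- The expectation over the other observations is a finite sum with weights frozen at `ε`, so the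
derivative passes inside and acts on each value of `S` separately. -/
theorem bscDerivMean_bscExpect {C : Type} [Fintype C] [DecidableEq C] {ε : ℝ} (h0 : 0 < ε)
    (h1 : ε < 1) {S : (C → ℝ) → ℝ} (hS : ∀ l, |S l| ≤ 1) :
    bscDerivMean ε (fun li => bscExpect ε fun l =>
      Real.log ((1 + S l * Real.tanh li) / (1 + Real.tanh li))) =
      bscExpect ε fun l => gexitKernel ε (S l) := by
  have e1 : (fun e => bscMean e fun li => bscExpect ε fun l =>
      Real.log ((1 + S l * Real.tanh li) / (1 + Real.tanh li))) =
      fun e => ∑ s : C → Bool, (∏ j, bscProb ε (s j)) * bscMean e fun li =>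
        Real.log ((1 + S (fun j => bscLLR ε (s j)) * Real.tanh li) / (1 + Real.tanh li)) := by
    funext e
    simp only [bscMean, bscExpect, Finset.mul_sum]
    rw [Finset.sum_comm]
    refine Finset.sum_congr rfl fun s _ => Finset.sum_congr rfl fun c _ => ?_
    ring
  unfold bscDerivMean
  rw [e1]
  have := HasDerivAt.fun_sum (u := Finset.univ) fun (s : C → Bool) _ =>
    (hasDerivAt_bscMean_log h0 h1 (hS fun j => bscLLR ε (s j))).const_mul (∏ j, bscProb ε (s j))
  rw [this.deriv]
  unfold bscExpect
  exact Finset.sum_congr rfl fun s _ => by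
    simp only [gexitKernel_eq h0 h1 (hS _)]

/-- `gexitKernel` extended continuously to `ℝ` by constants outside `[-1, 1]`. -/
def clampedKernel (ε x : ℝ) : ℝ := gexitKernel ε (max (-1) (min 1 x))

theorem clampedKernel_eq {ε x : ℝ} (hx : |x| ≤ 1) : clampedKernel ε x = gexitKernel ε x := by
  have := abs_le.1 hx
  rw [clampedKernel, min_eq_right this.2, max_eq_right this.1]

theorem exists_abs_clampedKernel_le {ε : ℝ} (h0 : 0 < ε) (h1 : ε < 1) :
    ∃ M, 0 < M ∧ ∀ x, |clampedKernel ε x| ≤ M := by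
  obtain ⟨M, hM⟩ := isCompact_Icc.exists_bound_of_continuousOn (continuousOn_gexitKernel h0 h1)
  refine ⟨max M 1, by positivity, fun x => (hM _ ⟨le_max_left _ _, ?_⟩).trans (le_max_left _ _)⟩
  exact max_le (by norm_num) (min_le_left _ _)

theorem exists_gexitKernel_uniform {ε : ℝ} (h0 : 0 < ε) (h1 : ε < 1) {η : ℝ} (hη : 0 < η) :
    ∃ δ > 0, ∀ x y : ℝ, |x| ≤ 1 → |y| ≤ 1 → |x - y| < δ →
      |gexitKernel ε x - gexitKernel ε y| < η := by
  have := isCompact_Icc.uniformContinuousOn_of_continuous (continuousOn_gexitKernel h0 h1)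
  rw [Metric.uniformContinuousOn_iff] at this
  obtain ⟨δ, hδ, h⟩ := this η hη
  exact ⟨δ, hδ, fun x y hx hy hxy => h x (abs_le.1 hx) y (abs_le.1 hy) hxy⟩

/-! ### Density evolution, with laws represented as functionals on test functions. -/

namespace DensityEvolution

/-- A mean with respect to a probability distribution, seen as a functional on test functions:
it is affine, and bounded above by upper bounds of the test function. -/
structure IsMean {α : Type} (I : (α → ℝ) → ℝ) : Prop where
  affine : ∀ (a b : ℝ) (ψ : α → ℝ), I (fun x => a + b * ψ x) = a + b * I ψ
  le_one : ∀ ψ : α → ℝ, (∀ x, ψ x ≤ 1) → I ψ ≤ 1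

/-- Continuous convergence of functionals: `I k (ψ k) → J ψ` whenever `ψ k → ψ` pointwise. -/
def ContConv {α : Type} (I : ℕ → (α → ℝ) → ℝ) (J : (α → ℝ) → ℝ) : Prop :=
  ∀ (ψ : ℕ → α → ℝ) (φ : α → ℝ), (∀ x, Tendsto (fun k => ψ k x) atTop (𝓝 (φ x))) →
    Tendsto (fun k => I k (ψ k)) atTop (𝓝 (J φ))

theorem isMean_eval {α : Type} (x : α) : IsMean fun ψ : α → ℝ => ψ x :=
  ⟨fun _ _ _ => rfl, fun _ h => h x⟩

theorem IsMean.map {α β : Type} {I : (α → ℝ) → ℝ} (h : IsMean I) (g : α → β) :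
    IsMean fun ψ : β → ℝ => I fun x => ψ (g x) :=
  ⟨fun a b ψ => h.affine a b fun x => ψ (g x), fun _ hψ => h.le_one _ fun x => hψ (g x)⟩

theorem IsMean.mix {α ι : Type} {s : Finset ι} {w : ι → ℝ} {I : ι → (α → ℝ) → ℝ}
    (hw : ∀ i ∈ s, 0 ≤ w i) (hsum : ∑ i ∈ s, w i = 1) (h : ∀ i ∈ s, IsMean (I i)) :
    IsMean fun ψ => ∑ i ∈ s, w i * I i ψ := by
  refine ⟨fun a b ψ => ?_, fun ψ hψ => ?_⟩
  · rw [Finset.mul_sum, Finset.sum_congr rfl fun i hi => by rw [(h i hi).affine a b ψ]]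
    simp only [mul_add, Finset.sum_add_distrib, ← Finset.sum_mul, hsum, one_mul]
    congr 1
    exact Finset.sum_congr rfl fun i _ => by ring
  · rw [← hsum]
    exact Finset.sum_le_sum fun i hi => mul_le_of_le_one_right (hw i hi) ((h i hi).le_one ψ hψ)

theorem ContConv.mix {α ι : Type} {s : Finset ι} {w : ℕ → ι → ℝ} {v : ι → ℝ}
    {I : ℕ → ι → (α → ℝ) → ℝ} {J : ι → (α → ℝ) → ℝ}
    (hw : ∀ i ∈ s, Tendsto (fun k => w k i) atTop (𝓝 (v i)))
    (h : ∀ i ∈ s, ContConv (fun k => I k i) (J i)) :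
    ContConv (fun k ψ => ∑ i ∈ s, w k i * I k i ψ) fun ψ => ∑ i ∈ s, v i * J i ψ :=
  fun ψ φ hψ => tendsto_finsetSum _ fun i hi => (hw i hi).mul (h i hi ψ φ hψ)

theorem ContConv.map {α β : Type} {I : ℕ → (α → ℝ) → ℝ} {J : (α → ℝ) → ℝ}
    (h : ContConv I J) (g : α → β) :
    ContConv (fun k (ψ : β → ℝ) => I k fun x => ψ (g x)) fun ψ => J fun x => ψ (g x) :=
  fun ψ φ hψ => h (fun k x => ψ k (g x)) (fun x => φ (g x)) fun x => hψ (g x)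

section Conv

variable {M : Type} [CommMonoid M]

/-- The mean with respect to the law of the product of `k` i.i.d. random variables. -/
def convPow (I : (M → ℝ) → ℝ) : ℕ → (M → ℝ) → ℝ
  | 0 => fun ψ => ψ 1
  | k + 1 => fun ψ => I fun x => convPow I k fun y => ψ (x * y)

theorem IsMean.convPow {I : (M → ℝ) → ℝ} (h : IsMean I) : ∀ k, IsMean (convPow I k)
  | 0 => isMean_eval 1
  | k + 1 => by
    refine ⟨fun a b ψ => ?_, fun ψ hψ => ?_⟩
    · simp only [DensityEvolution.convPow, (h.convPow k).affine, h.affine]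
    · exact h.le_one _ fun x => (h.convPow k).le_one _ fun y => hψ _

/-- The inner mean is the test function of the outer one and itself varies along the sequence; this
is why `ContConv` lets the test functions vary. -/
theorem ContConv.convPow {I : ℕ → (M → ℝ) → ℝ} {J : (M → ℝ) → ℝ} (h : ContConv I J) :
    ∀ k, ContConv (fun n => convPow (I n) k) (convPow J k)
  | 0 => fun _ _ hψ => hψ 1
  | k + 1 => fun _ _ hψ => h _ _ fun x => (h.convPow k) _ _ fun y => hψ (x * y)

end Conv

/-- One message passing step at a check node: `rho` is the degree distribution of the check node
at the end of a random edge, and `p`, `t` are the law and the values of the soft channel output. -/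
def chkMean (K : ℕ) (rho : ℕ → ℝ) (p t : Bool → ℝ) (I : (ℝ → ℝ) → ℝ) (ψ : ℝ × ℝ → ℝ) : ℝ :=
  ∑ k ∈ Finset.range (K + 1), rho k * ∑ c, p c *
    convPow I (k - 1) fun y => ψ (1 + t c * y, 1 - t c * y)

/-- One message passing step at a variable node: `lam` is the degree distribution of the variable
node at the end of a random edge. -/
def varMean (L : ℕ) (lam : ℕ → ℝ) (I : (ℝ × ℝ → ℝ) → ℝ) (ψ : ℝ → ℝ) : ℝ :=
  ∑ l ∈ Finset.range (L + 1), lam l *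
    convPow I (l - 1) fun x => ψ ((x.1 - x.2) / (x.1 + x.2))

/-- Density evolution: the mean with respect to the law of the message `TannerGraph.msg` in the
random tree with edge perspective degree distributions `lam` and `rho`. -/
def msgMean (L K : ℕ) (lam rho : ℕ → ℝ) (p t : Bool → ℝ) : ℕ → (ℝ → ℝ) → ℝ
  | 0 => fun ψ => ψ 1
  | 1 => fun ψ => ψ 0
  | r + 2 => varMean L lam (chkMean K rho p t (msgMean L K lam rho p t r))

variable {L K : ℕ} {lam rho : ℕ → ℝ} {p t : Bool → ℝ}

theorem IsMean.chkMean {I : (ℝ → ℝ) → ℝ} (h : IsMean I) (hr : ∀ k, 0 ≤ rho k)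
    (hr1 : ∑ k ∈ Finset.range (K + 1), rho k = 1) (hp : ∀ c, 0 ≤ p c) (hp1 : ∑ c, p c = 1) :
    IsMean (chkMean K rho p t I) :=
  IsMean.mix (I := fun k ψ => ∑ c, p c * DensityEvolution.convPow I (k - 1) fun y =>
      ψ (1 + t c * y, 1 - t c * y)) (fun k _ => hr k) hr1
    fun k _ => IsMean.mix (I := fun c ψ => DensityEvolution.convPow I (k - 1) fun y =>
      ψ (1 + t c * y, 1 - t c * y)) (fun c _ => hp c) hp1
      fun _ _ => (h.convPow _).map _

theorem IsMean.varMean {I : (ℝ × ℝ → ℝ) → ℝ} (h : IsMean I) (hl : ∀ k, 0 ≤ lam k)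
    (hl1 : ∑ k ∈ Finset.range (L + 1), lam k = 1) : IsMean (varMean L lam I) :=
  IsMean.mix (I := fun l ψ => DensityEvolution.convPow I (l - 1) fun x =>
    ψ ((x.1 - x.2) / (x.1 + x.2))) (fun k _ => hl k) hl1 fun _ _ => (h.convPow _).map _

theorem isMean_msgMean (hl : ∀ k, 0 ≤ lam k) (hl1 : ∑ k ∈ Finset.range (L + 1), lam k = 1)
    (hr : ∀ k, 0 ≤ rho k) (hr1 : ∑ k ∈ Finset.range (K + 1), rho k = 1)
    (hp : ∀ c, 0 ≤ p c) (hp1 : ∑ c, p c = 1) : ∀ r, IsMean (msgMean L K lam rho p t r)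
  | 0 => isMean_eval 1
  | 1 => isMean_eval 0
  | r + 2 => ((isMean_msgMean hl hl1 hr hr1 hp hp1 r).chkMean hr hr1 hp hp1).varMean hl hl1

theorem ContConv.chkMean {rhok : ℕ → ℕ → ℝ} {I : ℕ → (ℝ → ℝ) → ℝ} {J : (ℝ → ℝ) → ℝ}
    (h : ContConv I J) (hr : ∀ l, Tendsto (fun k => rhok k l) atTop (𝓝 (rho l))) :
    ContConv (fun k => chkMean K (rhok k) p t (I k)) (chkMean K rho p t J) :=
  ContConv.mix (s := Finset.range (K + 1)) (I := fun n k ψ => ∑ c, p c *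
      DensityEvolution.convPow (I n) (k - 1) fun y => ψ (1 + t c * y, 1 - t c * y))
    (J := fun k ψ => ∑ c, p c *
      DensityEvolution.convPow J (k - 1) fun y => ψ (1 + t c * y, 1 - t c * y))
    (fun k _ => hr k) fun k _ =>
    ContConv.mix (s := Finset.univ) (w := fun _ => p) (I := fun n c ψ =>
        DensityEvolution.convPow (I n) (k - 1) fun y => ψ (1 + t c * y, 1 - t c * y))
      (J := fun c ψ => DensityEvolution.convPow J (k - 1) fun y => ψ (1 + t c * y, 1 - t c * y))
      (fun _ _ => tendsto_const_nhds) fun _ _ => (h.convPow _).map _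

theorem ContConv.varMean {lamk : ℕ → ℕ → ℝ} {I : ℕ → (ℝ × ℝ → ℝ) → ℝ} {J : (ℝ × ℝ → ℝ) → ℝ}
    (h : ContConv I J) (hl : ∀ l, Tendsto (fun k => lamk k l) atTop (𝓝 (lam l))) :
    ContConv (fun k => varMean L (lamk k) (I k)) (varMean L lam J) :=
  ContConv.mix (s := Finset.range (L + 1)) (I := fun n l ψ =>
      DensityEvolution.convPow (I n) (l - 1) fun x => ψ ((x.1 - x.2) / (x.1 + x.2)))
    (J := fun l ψ => DensityEvolution.convPow J (l - 1) fun x => ψ ((x.1 - x.2) / (x.1 + x.2)))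
    (fun k _ => hl k) fun _ _ => (h.convPow _).map _

/-- Every law involved is supported on a finite set that does not depend on the degree fractions;
only the weights do. Pointwise convergence of test functions therefore suffices, with no continuity
assumption. -/
theorem contConv_msgMean {lamk rhok : ℕ → ℕ → ℝ}
    (hl : ∀ l, Tendsto (fun k => lamk k l) atTop (𝓝 (lam l)))
    (hr : ∀ l, Tendsto (fun k => rhok k l) atTop (𝓝 (rho l))) :
    ∀ r, ContConv (fun k => msgMean L K (lamk k) (rhok k) p t r) (msgMean L K lam rho p t r)
  | 0 => fun _ _ hψ => hψ 1
  | 1 => fun _ _ hψ => hψ 0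
  | r + 2 => ((contConv_msgMean hl hr r).chkMean hr).varMean hl

end DensityEvolution

/-! ### Exploration of a random configuration: cylinder events and simulation. -/

namespace NodeDegrees

open DensityEvolution

variable {n m : ℕ} (D : NodeDegrees n m)

/-- A matching of the sockets together with the channel flips at all check nodes. -/
abbrev Config : Type := (D.ChkSocket ≃ D.VarSocket) × (Fin n → Bool)

variable {D}

/-- The weight of a configuration, if the flips are i.i.d. with law `p`. -/
def weight (p : Bool → ℝ) (ω : D.Config) : ℝ := ∏ j, p (ω.2 j)

theorem weight_nonneg {p : Bool → ℝ} (hp : ∀ c, 0 ≤ p c) (ω : D.Config) : 0 ≤ weight p ω :=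
  Finset.prod_nonneg fun _ _ => hp _

variable (D)

/-- An event that arises in the exploration of a random configuration. It only depends on the
matching of the sockets in `usedChk` with the sockets in `usedVar`, and on the flips at the check
nodes in `chks`. -/
structure Cylinder where
  event : Finset D.Config
  usedChk : Finset D.ChkSocket
  usedVar : Finset D.VarSocket
  chks : Finset (Fin n)
  vars : Finset (Fin m)
  mem_used : ∀ ω ∈ event, ∀ e, e ∈ usedChk ↔ ω.1 e ∈ usedVar
  swap_mem : ∀ ω ∈ event, ∀ b b', b ∉ usedVar → b' ∉ usedVar →
    (ω.1.trans (Equiv.swap b b'), ω.2) ∈ event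
  flip_mem : ∀ ω ∈ event, ∀ j, j ∉ chks → ∀ c, (ω.1, Function.update ω.2 j c) ∈ event
  fst_mem_chks : ∀ e ∈ usedChk, e.1 ∈ chks
  fst_mem_vars : ∀ b ∈ usedVar, b.1 ∈ vars

variable {D}

namespace Cylinder

/-- The unnormalized mean of `f` on the event. -/
def mean (p : Bool → ℝ) (S : D.Cylinder) (f : D.Config → ℝ) : ℝ :=
  ∑ ω ∈ S.event, weight p ω * f ω

/-- The unnormalized probability of the event. -/
def mass (p : Bool → ℝ) (S : D.Cylinder) : ℝ := ∑ ω ∈ S.event, weight p ω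

theorem mass_nonneg {p : Bool → ℝ} (hp : ∀ c, 0 ≤ p c) (S : D.Cylinder) : 0 ≤ S.mass p :=
  Finset.sum_nonneg fun _ _ => weight_nonneg hp _

theorem mean_nonneg {p : Bool → ℝ} (hp : ∀ c, 0 ≤ p c) (S : D.Cylinder) {f : D.Config → ℝ}
    (hf : ∀ ω, 0 ≤ f ω) : 0 ≤ S.mean p f :=
  Finset.sum_nonneg fun _ _ => mul_nonneg (weight_nonneg hp _) (hf _)

/-- All unexplored sockets have the same probability to be matched with a given one. -/
theorem mass_le_card_mul {p : Bool → ℝ} (hp : ∀ c, 0 ≤ p c) (S : D.Cylinder) {e : D.ChkSocket}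
    {b : D.VarSocket} (he : e ∉ S.usedChk) (hb : b ∉ S.usedVar) :
    S.mass p ≤ Fintype.card D.VarSocket *
      ∑ ω ∈ S.event.filter (fun ω => ω.1 e = b), weight p ω := by
  -- Swapping two unexplored variable sockets is a weight-preserving involution of the event, so all
  -- of them are equally likely partners of `e`.
  have hle : ∀ b b', b ∉ S.usedVar → b' ∉ S.usedVar →
      ∑ ω ∈ S.event.filter (fun ω => ω.1 e = b'), weight p ω =
        ∑ ω ∈ S.event.filter (fun ω => ω.1 e = b), weight p ω := by
    intro b b' hb hb'
    refine Finset.sum_bij' (fun ω _ => (ω.1.trans (Equiv.swap b b'), ω.2))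
      (fun ω _ => (ω.1.trans (Equiv.swap b b'), ω.2)) ?_ ?_ ?_ ?_ ?_
    · intro ω hω
      rw [Finset.mem_filter] at hω ⊢
      exact ⟨S.swap_mem ω hω.1 b b' hb hb', by simp [hω.2]⟩
    · intro ω hω
      rw [Finset.mem_filter] at hω ⊢
      exact ⟨S.swap_mem ω hω.1 b b' hb hb', by simp [hω.2]⟩
    · intro ω _
      refine Prod.ext ?_ rfl
      ext x : 1
      simp
    · intro ω _
      refine Prod.ext ?_ rfl
      ext x : 1
      simp
    · intro ω _; rfl
  have hmaps : ∀ ω ∈ S.event, ω.1 e ∈ Finset.univ.filter (fun b' => b' ∉ S.usedVar) := by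
    intro ω hω
    simpa [← S.mem_used ω hω e] using he
  rw [mass, ← Finset.sum_fiberwise_of_maps_to hmaps,
    Finset.sum_congr rfl fun b' hb' => hle b b' hb (by simpa using hb'),
    Finset.sum_const, nsmul_eq_mul]
  refine mul_le_mul_of_nonneg_right ?_ (Finset.sum_nonneg fun _ _ => weight_nonneg hp _)
  exact_mod_cast Finset.card_le_univ _

/-- Given an event that is indifferent to the flip at `j`, that flip still has law `p`: resetting it
to another value changes a single factor of the weight. -/
theorem sum_flip {p : Bool → ℝ} (hp1 : ∑ c, p c = 1) {A : Finset D.Config} {j : Fin n}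
    (hA : ∀ ω ∈ A, ∀ c, (ω.1, Function.update ω.2 j c) ∈ A) (c : Bool) :
    p c * ∑ ω ∈ A, weight p ω = ∑ ω ∈ A.filter (fun ω => ω.2 j = c), weight p ω := by
  have key : ∀ c', p c * ∑ ω ∈ A.filter (fun ω => ω.2 j = c'), weight p ω =
      p c' * ∑ ω ∈ A.filter (fun ω => ω.2 j = c), weight p ω := by
    intro c'
    rw [Finset.mul_sum, Finset.mul_sum]
    refine Finset.sum_bij' (fun ω _ => (ω.1, Function.update ω.2 j c))
      (fun ω _ => (ω.1, Function.update ω.2 j c')) ?_ ?_ ?_ ?_ ?_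
    · intro ω hω
      rw [Finset.mem_filter] at hω ⊢
      exact ⟨hA ω hω.1 c, by simp⟩
    · intro ω hω
      rw [Finset.mem_filter] at hω ⊢
      exact ⟨hA ω hω.1 c', by simp⟩
    · intro ω hω
      rw [Finset.mem_filter] at hω
      obtain ⟨_, rfl⟩ := hω
      simp
    · intro ω hω
      rw [Finset.mem_filter] at hω
      obtain ⟨_, rfl⟩ := hω
      simp
    · intro ω hω
      rw [Finset.mem_filter] at hω
      obtain ⟨_, rfl⟩ := hω
      simp only [weight]
      rw [← Finset.mul_prod_erase _ _ (Finset.mem_univ j),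
        ← Finset.mul_prod_erase _ (fun i => p (Function.update ω.2 j c i)) (Finset.mem_univ j),
        Function.update_self]
      have : ∏ i ∈ Finset.univ.erase j, p (Function.update ω.2 j c i) =
          ∏ i ∈ Finset.univ.erase j, p (ω.2 i) :=
        Finset.prod_congr rfl fun i hi => by
          rw [Function.update_of_ne (Finset.ne_of_mem_erase hi)]
      rw [this]
      ring
  rw [← Finset.sum_fiberwise A (fun ω => ω.2 j), Finset.mul_sum,
    Finset.sum_congr rfl fun c' _ => key c', ← Finset.sum_mul, hp1, one_mul]

/-- The exploration of the variable node at the end of the check socket `e`. -/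
def revealVar (S : D.Cylinder) (e : D.ChkSocket) (b : D.VarSocket) (he : e.1 ∈ S.chks) :
    D.Cylinder where
  event := S.event.filter fun ω => ω.1 e = b
  usedChk := insert e S.usedChk
  usedVar := insert b S.usedVar
  chks := S.chks
  vars := insert b.1 S.vars
  mem_used ω hω e' := by
    rw [Finset.mem_filter] at hω
    rw [Finset.mem_insert, Finset.mem_insert, S.mem_used ω hω.1, ← hω.2, ω.1.injective.eq_iff]
  swap_mem ω hω b₁ b₂ h₁ h₂ := by
    rw [Finset.mem_filter] at hω ⊢
    rw [Finset.mem_insert, not_or] at h₁ h₂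
    refine ⟨S.swap_mem ω hω.1 _ _ h₁.2 h₂.2, ?_⟩
    rw [Equiv.trans_apply, hω.2, Equiv.swap_apply_of_ne_of_ne (Ne.symm h₁.1) (Ne.symm h₂.1)]
  flip_mem ω hω j hj c := by
    rw [Finset.mem_filter] at hω ⊢
    exact ⟨S.flip_mem ω hω.1 j hj c, hω.2⟩
  fst_mem_chks e' h := by
    rcases Finset.mem_insert.1 h with rfl | h
    · exact he
    · exact S.fst_mem_chks _ h
  fst_mem_vars b' h := by
    rcases Finset.mem_insert.1 h with rfl | h
    · exact Finset.mem_insert_self _ _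
    · exact Finset.mem_insert_of_mem (S.fst_mem_vars _ h)

/-- The exploration of the check node at the end of the variable socket `b`, and of the flip at
this check node. -/
def revealChk (S : D.Cylinder) (b : D.VarSocket) (e : D.ChkSocket) (c : Bool)
    (hb : b.1 ∈ S.vars) : D.Cylinder where
  event := (S.event.filter fun ω => ω.1 e = b).filter fun ω => ω.2 e.1 = c
  usedChk := insert e S.usedChk
  usedVar := insert b S.usedVar
  chks := insert e.1 S.chks
  vars := S.vars
  mem_used ω hω e' := by
    rw [Finset.mem_filter, Finset.mem_filter] at hω
    rw [Finset.mem_insert, Finset.mem_insert, S.mem_used ω hω.1.1, ← hω.1.2,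
      ω.1.injective.eq_iff]
  swap_mem ω hω b₁ b₂ h₁ h₂ := by
    rw [Finset.mem_filter, Finset.mem_filter] at hω ⊢
    rw [Finset.mem_insert, not_or] at h₁ h₂
    refine ⟨⟨S.swap_mem ω hω.1.1 _ _ h₁.2 h₂.2, ?_⟩, hω.2⟩
    rw [Equiv.trans_apply, hω.1.2, Equiv.swap_apply_of_ne_of_ne (Ne.symm h₁.1) (Ne.symm h₂.1)]
  flip_mem ω hω j hj c' := by
    rw [Finset.mem_filter, Finset.mem_filter] at hω ⊢
    rw [Finset.mem_insert, not_or] at hj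
    exact ⟨⟨S.flip_mem ω hω.1.1 j hj.2 c', hω.1.2⟩,
      (Function.update_of_ne (Ne.symm hj.1) _ _).trans hω.2⟩
  fst_mem_chks e' h := by
    rcases Finset.mem_insert.1 h with rfl | h
    · exact Finset.mem_insert_self _ _
    · exact Finset.mem_insert_of_mem (S.fst_mem_chks _ h)
  fst_mem_vars b' h := by
    rcases Finset.mem_insert.1 h with rfl | h
    · exact hb
    · exact S.fst_mem_vars _ h

/-- `S'` arises from `S` by the exploration of at most `c` further nodes on either side, whereby
no sockets of the nodes of `S` are used besides those in `FE` and `FB`. -/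
structure Extends (S S' : D.Cylinder) (FE : Set D.ChkSocket) (FB : Set D.VarSocket) (c : ℕ) :
    Prop where
  chks_subset : S.chks ⊆ S'.chks
  vars_subset : S.vars ⊆ S'.vars
  card_chks : S'.chks.card ≤ S.chks.card + c
  card_vars : S'.vars.card ≤ S.vars.card + c
  usedChk : ∀ e ∈ S'.usedChk, e.1 ∈ S.chks → e ∈ S.usedChk ∨ e ∈ FE
  usedVar : ∀ b ∈ S'.usedVar, b.1 ∈ S.vars → b ∈ S.usedVar ∨ b ∈ FB

theorem Extends.refl (S : D.Cylinder) (FE : Set D.ChkSocket) (FB : Set D.VarSocket) (c : ℕ) :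
    S.Extends S FE FB c :=
  ⟨subset_rfl, subset_rfl, Nat.le_add_right _ _, Nat.le_add_right _ _, fun _ h _ => Or.inl h,
    fun _ h _ => Or.inl h⟩

theorem Extends.trans {S S' S'' : D.Cylinder} {FE FE' FE'' : Set D.ChkSocket}
    {FB FB' FB'' : Set D.VarSocket} {c c' : ℕ} (h : S.Extends S' FE FB c)
    (h' : S'.Extends S'' FE' FB' c') (hE : FE ⊆ FE'') (hE' : ∀ e ∈ FE', e.1 ∈ S.chks → e ∈ FE'')
    (hB : FB ⊆ FB'') (hB' : ∀ b ∈ FB', b.1 ∈ S.vars → b ∈ FB'') :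
    S.Extends S'' FE'' FB'' (c + c') where
  chks_subset := h.chks_subset.trans h'.chks_subset
  vars_subset := h.vars_subset.trans h'.vars_subset
  card_chks := by have := h.card_chks; have := h'.card_chks; omega
  card_vars := by have := h.card_vars; have := h'.card_vars; omega
  usedChk e he hS := by
    rcases h'.usedChk e he (h.chks_subset hS) with h1 | h1
    · exact (h.usedChk e h1 hS).imp id fun h2 => hE h2
    · exact Or.inr (hE' e h1 hS)
  usedVar b hb hS := by
    rcases h'.usedVar b hb (h.vars_subset hS) with h1 | h1
    · exact (h.usedVar b h1 hS).imp id fun h2 => hB h2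
    · exact Or.inr (hB' b h1 hS)

theorem Extends.mono {S S' : D.Cylinder} {FE FE' : Set D.ChkSocket}
    {FB FB' : Set D.VarSocket} {c c' : ℕ} (h : S.Extends S' FE FB c)
    (hE : FE ⊆ FE') (hB : FB ⊆ FB') (hc : c ≤ c') : S.Extends S' FE' FB' c' where
  chks_subset := h.chks_subset
  vars_subset := h.vars_subset
  card_chks := h.card_chks.trans (by omega)
  card_vars := h.card_vars.trans (by omega)
  usedChk e he hS := (h.usedChk e he hS).imp id fun h2 => hE h2
  usedVar b hb hS := (h.usedVar b hb hS).imp id fun h2 => hB h2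

/-- Conditionally on `S`, the random variable `f` can be computed by the exploration of at most
`c` nodes, and its conditional law is, up to an error `c * η`, bounded below by the law with mean
`I`; this remains true jointly with everything that is explored afterwards, `Ψ x` standing for the
outcome of the subsequent exploration. At most `B` nodes are explored on either side. -/
def Simulates {α : Type} (p : Bool → ℝ) (η : ℝ) (B : ℕ) (c : ℕ) (S : D.Cylinder)
    (FE : Set D.ChkSocket) (FB : Set D.VarSocket) (f : D.Config → α) (I : (α → ℝ) → ℝ) : Prop :=
  S.chks.card + c ≤ B → S.vars.card + c ≤ B →
  ∀ (Ψ : α → D.Config → ℝ) (ψ : α → ℝ) (δ : ℝ), (∀ x ω, 0 ≤ Ψ x ω) → (∀ x, ψ x ≤ 1) → 0 ≤ δ →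
    (∀ x S', S.Extends S' FE FB c → S'.mass p * (ψ x - δ) ≤ S'.mean p (Ψ x)) →
    S.mass p * (I ψ - δ - c * η) ≤ S.mean p fun ω => Ψ (f ω) ω

section Simulates

variable {α : Type} {p : Bool → ℝ} {η : ℝ} {B : ℕ} {S : D.Cylinder}
  {FE : Set D.ChkSocket} {FB : Set D.VarSocket}

theorem Simulates.congr {c : ℕ} {f g : D.Config → α} {I : (α → ℝ) → ℝ}
    (h : Simulates p η B c S FE FB f I) (hfg : ∀ ω ∈ S.event, f ω = g ω) :
    Simulates p η B c S FE FB g I := by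
  intro h1 h2 Ψ ψ δ h3 h4 h5 h6
  refine (h h1 h2 Ψ ψ δ h3 h4 h5 h6).trans_eq ?_
  exact Finset.sum_congr rfl fun ω hω => by simp only [hfg ω hω]

theorem Simulates.map {β : Type} {c : ℕ} {f : D.Config → α} {I : (α → ℝ) → ℝ}
    (h : Simulates p η B c S FE FB f I) (g : α → β) :
    Simulates p η B c S FE FB (fun ω => g (f ω)) fun ψ => I fun x => ψ (g x) :=
  fun h1 h2 Ψ ψ δ h3 h4 h5 h6 => h h1 h2 (fun x => Ψ (g x)) (fun x => ψ (g x)) δ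
    (fun x => h3 (g x)) (fun x => h4 (g x)) h5 fun x => h6 (g x)

theorem Simulates.mono {c c' : ℕ} {FE' : Set D.ChkSocket} {FB' : Set D.VarSocket}
    {f : D.Config → α} {I : (α → ℝ) → ℝ} (hp : ∀ c, 0 ≤ p c) (hη : 0 ≤ η)
    (h : Simulates p η B c S FE FB f I) (hc : c ≤ c') (hE : FE ⊆ FE') (hB : FB ⊆ FB') :
    Simulates p η B c' S FE' FB' f I := by
  intro h1 h2 Ψ ψ δ h3 h4 h5 h6
  have h7 := h (by omega) (by omega) Ψ ψ δ h3 h4 h5 fun x S' hS' => h6 x S' (hS'.mono hE hB hc)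
  refine le_trans (mul_le_mul_of_nonneg_left ?_ (S.mass_nonneg hp)) h7
  have : (c : ℝ) * η ≤ c' * η := mul_le_mul_of_nonneg_right (by exact_mod_cast hc) hη
  linarith

theorem simulates_const (x : α) : Simulates p η B 0 S FE FB (fun _ => x) fun ψ => ψ x := by
  intro _ _ Ψ ψ δ _ _ _ h6
  simpa using h6 x S (Extends.refl _ _ _ _)

/-- The computation of `g` is treated as part of what follows the exploration for `f`. The
hypothesis on `f` is used with the continuation ω ↦ Ψ(x · g ω) ω and slack `δ + c' * η`, which `h'`
justifies after each outcome of the first exploration. -/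
theorem Simulates.mul {M : Type} [CommMonoid M] {c c' : ℕ} {FE' : Set D.ChkSocket}
    {FB' : Set D.VarSocket} {f g : D.Config → M} {I J : (M → ℝ) → ℝ} (hη : 0 ≤ η)
    (hJ : IsMean J) (h : Simulates p η B c S FE FB f I)
    (h' : ∀ S', S.Extends S' FE FB c → Simulates p η B c' S' FE' FB' g J) :
    Simulates p η B (c + c') S (FE ∪ FE') (FB ∪ FB') (fun ω => f ω * g ω)
      fun ψ => I fun x => J fun y => ψ (x * y) := by
  intro h1 h2 Ψ ψ δ h3 h4 h5 h6
  have key := h (by omega) (by omega) (fun x ω => Ψ (x * g ω) ω) (fun x => J fun y => ψ (x * y))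
    (δ + c' * η) (fun x ω => h3 _ _) (fun x => hJ.le_one _ fun y => h4 _) (by positivity) ?_
  · convert key using 2
    push_cast
    ring
  · intro x S' hS'
    have := hS'.card_chks
    have := hS'.card_vars
    have h7 := h' S' hS' (by omega) (by omega) (fun y => Ψ (x * y)) (fun y => ψ (x * y)) δ
      (fun y => h3 _) (fun y => h4 _) h5 fun y S'' hS'' =>
        h6 (x * y) S'' (hS'.trans hS'' Set.subset_union_left (fun e he _ => Or.inr he)
          Set.subset_union_left (fun e he _ => Or.inr he))
    rw [← sub_sub]
    convert h7 using 2

/-- The factors are explored one after another. `Pre i` is the state in which factor `i` can still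
be explored; `hpers` says that the exploration of another factor does not destroy it, which replaces
independence. -/
theorem Simulates.prod {M ι : Type} [CommMonoid M] {c : ℕ} {s : Finset ι}
    {GE : ι → Set D.ChkSocket} {GB : ι → Set D.VarSocket} {f : ι → D.Config → M}
    {I : (M → ℝ) → ℝ} (hη : 0 ≤ η) (hI : IsMean I) (Pre : ι → D.Cylinder → Prop)
    (hf : ∀ i ∈ s, ∀ S, Pre i S → Simulates p η B c S (GE i) (GB i) (f i) I)
    (hpers : ∀ i ∈ s, ∀ j ∈ s, i ≠ j → ∀ S S' : D.Cylinder, Pre i S →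
      S.Extends S' (GE j) (GB j) c → Pre i S') (hS : ∀ i ∈ s, Pre i S) :
    Simulates p η B (s.card * c) S (⋃ i ∈ s, GE i) (⋃ i ∈ s, GB i) (fun ω => ∏ i ∈ s, f i ω)
      (convPow I s.card) := by
  classical
  induction s using Finset.induction_on generalizing S with
  | empty => simpa [convPow] using simulates_const (S := S) (1 : M)
  | insert a s ha ih =>
    have h1 := hf a (Finset.mem_insert_self _ _) S (hS a (Finset.mem_insert_self _ _))
    have h2 := h1.mul hη (hI.convPow s.card) fun S' hS' =>
      ih (S := S') (fun i hi => hf i (Finset.mem_insert_of_mem hi))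
        (fun i hi j hj => hpers i (Finset.mem_insert_of_mem hi) j (Finset.mem_insert_of_mem hj))
        fun i hi => hpers i (Finset.mem_insert_of_mem hi) a (Finset.mem_insert_self _ _)
          (fun h => ha (h ▸ hi)) S S' (hS i (Finset.mem_insert_of_mem hi)) hS'
    rw [Finset.card_insert_of_notMem ha, add_mul, one_mul, add_comm (s.card * c)]
    simp only [Finset.prod_insert ha, Finset.set_biUnion_insert]
    exact h2

/-- The effect of the exploration of one more node. -/
theorem Simulates.branch {ι : Type} [Fintype ι] [DecidableEq ι] {c : ℕ} {f : D.Config → α}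
    {I : ι → (α → ℝ) → ℝ} (hp : ∀ c, 0 ≤ p c) (hη : 0 ≤ η) (good : Finset ι) (T : ι → D.Cylinder)
    (w : ι → ℝ) (GE : Set D.ChkSocket) (GB : Set D.VarSocket)
    (hsub : ∀ x ∈ good, (T x).event ⊆ S.event)
    (hdisj : ∀ x ∈ good, ∀ y ∈ good, x ≠ y → Disjoint (T x).event (T y).event)
    (hmass : ∀ x ∈ good, S.mass p * w x ≤ (T x).mass p) (hw : ∀ x, 0 ≤ w x)
    (hw1 : ∑ x, w x = 1)
    (hbad : S.chks.card ≤ B → S.vars.card ≤ B → ∑ x ∈ goodᶜ, w x ≤ η)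
    (hI : ∀ x, IsMean (I x))
    (hsim : ∀ x ∈ good, Simulates p η B c (T x) GE GB f (I x))
    (hT : ∀ x ∈ good, S.Extends (T x) FE FB 1)
    (hGE : ∀ e ∈ GE, e.1 ∈ S.chks → e ∈ FE) (hGB : ∀ b ∈ GB, b.1 ∈ S.vars → b ∈ FB) :
    Simulates p η B (c + 1) S FE FB f fun ψ => ∑ x, w x * I x ψ := by
  intro h1 h2 Ψ ψ δ h3 h4 h5 h6
  have hbad' := hbad (by omega) (by omega)
  have hmean : ∀ x ∈ good, (T x).mass p * (I x ψ - δ - c * η) ≤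
      (T x).mean p fun ω => Ψ (f ω) ω := by
    intro x hx
    have h7 := (hT x hx).card_chks
    have h8 := (hT x hx).card_vars
    refine hsim x hx (by omega) (by omega) Ψ ψ δ h3 h4 h5 fun y S' hS' => h6 y S' ?_
    rw [add_comm c]
    exact (hT x hx).trans hS' subset_rfl hGE subset_rfl hGB
  have hM := S.mass_nonneg hp
  have hmean' : ∀ x ∈ good, S.mass p * (w x * (I x ψ - δ - c * η)) ≤
      (T x).mean p fun ω => Ψ (f ω) ω := by
    intro x hx
    rw [← mul_assoc]
    -- Only a lower bound on the mass of `T x` is known. If the bracket is negative, the claim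
    -- follows from nonnegativity of `Ψ` instead.
    rcases le_total 0 (I x ψ - δ - c * η) with ha | ha
    · exact (mul_le_mul_of_nonneg_right (hmass x hx) ha).trans (hmean x hx)
    · exact (mul_nonpos_of_nonneg_of_nonpos (mul_nonneg hM (hw x)) ha).trans
        ((T x).mean_nonneg hp fun ω => h3 _ _)
  have hsum : ∑ x ∈ good, (T x).mean p (fun ω => Ψ (f ω) ω) ≤ S.mean p fun ω => Ψ (f ω) ω := by
    have hd : (good : Set ι).PairwiseDisjoint fun x => (T x).event :=
      fun x hx y hy hxy => hdisj x hx y hy hxy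
    have := Finset.sum_biUnion (f := fun ω => weight p ω * Ψ (f ω) ω) hd
    unfold mean
    rw [← this]
    exact Finset.sum_le_sum_of_subset_of_nonneg (Finset.biUnion_subset.2 hsub)
      fun ω _ _ => mul_nonneg (weight_nonneg hp _) (h3 _ _)
  refine le_trans ?_ ((Finset.sum_le_sum hmean').trans hsum)
  rw [← Finset.mul_sum]
  refine mul_le_mul_of_nonneg_left ?_ hM
  have hsplit : ∑ x ∈ good, w x + ∑ x ∈ goodᶜ, w x = 1 := by
    rw [Finset.sum_add_sum_compl, hw1]
  have hsplitI : ∑ x ∈ good, w x * I x ψ + ∑ x ∈ goodᶜ, w x * I x ψ = ∑ x, w x * I x ψ :=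
    Finset.sum_add_sum_compl _ _
  -- Since `ψ ≤ 1`, discarding the bad outcomes loses at most their total weight; this is the one
  -- `η` charged for the step.
  have hle : ∑ x ∈ goodᶜ, w x * I x ψ ≤ ∑ x ∈ goodᶜ, w x :=
    Finset.sum_le_sum fun x _ => mul_le_of_le_one_right (hw x) ((hI x).le_one ψ h4)
  have hexp : ∑ x ∈ good, w x * (I x ψ - δ - c * η) =
      ∑ x ∈ good, w x * I x ψ - (δ + c * η) * ∑ x ∈ good, w x := by
    rw [Finset.mul_sum, ← Finset.sum_sub_distrib]
    exact Finset.sum_congr rfl fun x _ => by ring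
  have hnn : 0 ≤ ∑ x ∈ goodᶜ, w x := Finset.sum_nonneg fun x _ => hw x
  have hcη : 0 ≤ δ + c * η := by positivity
  rw [hexp]
  push_cast
  nlinarith

end Simulates

end Cylinder

end NodeDegrees

/-! ### Local exploration reproduces density evolution up to collisions. -/

namespace NodeDegrees

open DensityEvolution Cylinder

variable {n m : ℕ} (D : NodeDegrees n m)

/-- The fraction of edges whose variable node has degree `l`. -/
def varEdgeFrac (l : ℕ) : ℝ :=
  l * (Finset.univ.filter fun a => D.varDeg a = l).card / Fintype.card D.VarSocket

/-- The fraction of edges whose check node has degree `k`. -/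
def chkEdgeFrac (k : ℕ) : ℝ :=
  k * (Finset.univ.filter fun i => D.chkDeg i = k).card / Fintype.card D.VarSocket

theorem card_varSocket : Fintype.card D.VarSocket = ∑ a, D.varDeg a := by simp

theorem card_chkSocket : Fintype.card D.ChkSocket = Fintype.card D.VarSocket := by
  simp [D.sum_eq]

theorem varEdgeFrac_nonneg (l : ℕ) : 0 ≤ D.varEdgeFrac l := by unfold varEdgeFrac; positivity

theorem chkEdgeFrac_nonneg (l : ℕ) : 0 ≤ D.chkEdgeFrac l := by unfold chkEdgeFrac; positivity

/-- A uniformly chosen socket belongs to a node of size-biased degree: a node of degree l owns l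
sockets. -/
theorem sum_deg_eq {ι : Type} [Fintype ι] (deg : ι → ℕ) {L : ℕ} (hL : ∀ a, deg a ≤ L)
    (N : ℝ) (F : ℕ → ℝ) :
    ∑ b : (Σ a, Fin (deg a)), 1 / N * F (deg b.1) = ∑ l ∈ Finset.range (L + 1),
      (l * (Finset.univ.filter fun a => deg a = l).card / N : ℝ) * F l := by
  rw [Fintype.sum_sigma]
  simp only [Finset.sum_const, Finset.card_univ, Fintype.card_fin, nsmul_eq_mul]
  rw [← Finset.sum_fiberwise_of_maps_to (t := Finset.range (L + 1)) (g := deg)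
    fun a _ => Finset.mem_range.2 (Nat.lt_succ_of_le (hL a))]
  refine Finset.sum_congr rfl fun l _ => ?_
  rw [Finset.sum_congr rfl fun a ha => by rw [(Finset.mem_filter.1 ha).2], Finset.sum_const,
    nsmul_eq_mul]
  ring

theorem sum_varSocket {L : ℕ} (hL : ∀ a, D.varDeg a ≤ L) (F : ℕ → ℝ) :
    ∑ b : D.VarSocket, 1 / (Fintype.card D.VarSocket : ℝ) * F (D.varDeg b.1) =
      ∑ l ∈ Finset.range (L + 1), D.varEdgeFrac l * F l :=
  sum_deg_eq D.varDeg hL _ F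

theorem sum_chkSocket {K : ℕ} (hK : ∀ a, D.chkDeg a ≤ K) (F : ℕ → ℝ) :
    ∑ b : D.ChkSocket, 1 / (Fintype.card D.VarSocket : ℝ) * F (D.chkDeg b.1) =
      ∑ l ∈ Finset.range (K + 1), D.chkEdgeFrac l * F l :=
  sum_deg_eq D.chkDeg hK _ F

theorem sum_varEdgeFrac {L : ℕ} (hL : ∀ a, D.varDeg a ≤ L) (hN : 0 < Fintype.card D.VarSocket) :
    ∑ l ∈ Finset.range (L + 1), D.varEdgeFrac l = 1 := by
  have := D.sum_varSocket hL fun _ => 1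
  simp only [mul_one, Finset.sum_const, Finset.card_univ, nsmul_eq_mul] at this
  rw [← this, mul_one_div_cancel (by positivity)]

theorem sum_chkEdgeFrac {K : ℕ} (hK : ∀ a, D.chkDeg a ≤ K) (hN : 0 < Fintype.card D.VarSocket) :
    ∑ l ∈ Finset.range (K + 1), D.chkEdgeFrac l = 1 := by
  have := D.sum_chkSocket hK fun _ => 1
  simp only [mul_one, Finset.sum_const, Finset.card_univ, nsmul_eq_mul] at this
  rw [← this, D.card_chkSocket, mul_one_div_cancel (by positivity)]

/-- The collision probability: at most `B` explored nodes own at most `L * B` sockets. -/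
theorem sum_filter_fst_mem_le {ι : Type} [Fintype ι] [DecidableEq ι] {deg : ι → ℕ} {L B : ℕ}
    (hL : ∀ a, deg a ≤ L) {A : Finset ι} (hA : A.card ≤ B) {N η : ℝ} (hN : 0 ≤ N)
    (hη : L * B / N ≤ η) :
    ∑ _b ∈ Finset.univ.filter (fun b : Σ a, Fin (deg a) => b.1 ∈ A), 1 / N ≤ η := by
  have hcard : (Finset.univ.filter (fun b : Σ a, Fin (deg a) => b.1 ∈ A)).card ≤ L * B := by
    have : Finset.univ.filter (fun b : Σ a, Fin (deg a) => b.1 ∈ A) =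
        A.sigma fun a => Finset.univ := by ext b; simp
    rw [this, Finset.card_sigma]
    simp only [Finset.card_univ, Fintype.card_fin]
    calc ∑ a ∈ A, deg a ≤ ∑ a ∈ A, L := Finset.sum_le_sum fun a _ => hL a
      _ = A.card * L := by simp
      _ ≤ L * B := by rw [mul_comm]; exact Nat.mul_le_mul_left _ hA
  rw [Finset.sum_const, nsmul_eq_mul, mul_one_div]
  refine le_trans (div_le_div_of_nonneg_right ?_ hN) hη
  exact_mod_cast hcard

variable {D}

/-- The soft channel outputs, set to `0` at the check node `i₀`. -/
def softOut (t : Bool → ℝ) (i₀ : Fin n) (ω : D.Config) (j : Fin n) : ℝ :=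
  if j = i₀ then 0 else t (ω.2 j)

/-- The message `msg` in the graph of a configuration. -/
def configMsg (t : Bool → ℝ) (i₀ : Fin n) (r : ℕ) (e : D.ChkSocket) (ω : D.Config) : ℝ :=
  (D.graph ω.1).msg (softOut t i₀ ω) r e

/-- The message from the check node at the end of the variable socket `b`, as a factor in the
computation of the message of the variable node. -/
def configPair (t : Bool → ℝ) (i₀ : Fin n) (r : ℕ) (b : D.VarSocket) (ω : D.Config) : ℝ × ℝ :=
  (1 + softOut t i₀ ω (ω.1.symm b).1 *
      ∏ e ∈ (D.graph ω.1).chkNbrs (ω.1.symm b), configMsg t i₀ r e ω,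
    1 - softOut t i₀ ω (ω.1.symm b).1 *
      ∏ e ∈ (D.graph ω.1).chkNbrs (ω.1.symm b), configMsg t i₀ r e ω)

theorem sigma_mk_fst_eq_iff {ι : Type} {κ : ι → Type} {e : Σ i, κ i} {s : κ e.1} :
    (⟨e.1, s⟩ : Σ i, κ i) = e ↔ s = e.2 := by
  obtain ⟨i, s'⟩ := e
  simp

theorem mem_chkNbrs {σ : D.ChkSocket ≃ D.VarSocket} {e e' : D.ChkSocket} :
    e' ∈ (D.graph σ).chkNbrs e ↔ e'.1 = e.1 ∧ e' ≠ e :=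
  TannerGraph.mem_chkNbrs

theorem mem_varNbrs {σ : D.ChkSocket ≃ D.VarSocket} {e e' : D.ChkSocket} :
    e' ∈ (D.graph σ).varNbrs e ↔ (σ e').1 = (σ e).1 ∧ e' ≠ e :=
  TannerGraph.mem_varNbrs

theorem prod_chkNbrs (ω : D.Config) (e : D.ChkSocket) (g : D.ChkSocket → ℝ) :
    ∏ e' ∈ (D.graph ω.1).chkNbrs e, g e' = ∏ s ∈ Finset.univ.erase e.2, g ⟨e.1, s⟩ := by
  obtain ⟨j, s⟩ := e
  symm
  refine Finset.prod_bij (fun s' _ => ⟨j, s'⟩) ?_ ?_ ?_ fun _ _ => rfl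
  · intro s' hs'
    rw [mem_chkNbrs]
    simpa using hs'
  · intro s₁ _ s₂ _ h
    simpa using h
  · rintro ⟨j', s'⟩ h
    rw [mem_chkNbrs] at h
    obtain ⟨rfl, h⟩ := h
    exact ⟨s', by simpa using h, rfl⟩

theorem prod_varNbrs {ω : D.Config} {e : D.ChkSocket} {b : D.VarSocket} (hb : ω.1 e = b)
    (g : D.ChkSocket → ℝ) :
    ∏ e' ∈ (D.graph ω.1).varNbrs e, g e' =
      ∏ s ∈ Finset.univ.erase b.2, g (ω.1.symm ⟨b.1, s⟩) := by
  obtain ⟨a, s⟩ := b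
  symm
  have he : e = ω.1.symm ⟨a, s⟩ := by rw [← hb, Equiv.symm_apply_apply]
  refine Finset.prod_bij (fun s' _ => ω.1.symm ⟨a, s'⟩) ?_ ?_ ?_ fun _ _ => rfl
  · intro s' hs'
    rw [mem_varNbrs]
    simpa [he] using hs'
  · intro s₁ _ s₂ _ h
    simpa using h
  · intro e' h
    rw [mem_varNbrs, hb] at h
    obtain ⟨h1, h2⟩ := h
    rcases he' : ω.1 e' with ⟨a', s'⟩
    rw [he'] at h1
    simp only at h1
    subst h1
    refine ⟨s', ?_, by rw [← he', Equiv.symm_apply_apply]⟩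
    rw [Finset.mem_erase]
    refine ⟨fun h3 => h2 ?_, Finset.mem_univ _⟩
    have h4 : s' = s := h3
    rw [he, ← h4, ← he', Equiv.symm_apply_apply]

/-- Carrying the pair (1 + s, 1 - s) as an element of the multiplicative monoid ℝ × ℝ turns the
update at a variable node into a product followed by a fixed map, so that `Simulates.prod` applies.
-/
theorem configMsg_eq {t : Bool → ℝ} {i₀ : Fin n} {r : ℕ} {ω : D.Config} {e : D.ChkSocket}
    {b : D.VarSocket} (hb : ω.1 e = b) :
    configMsg t i₀ (r + 2) e ω =
      ((∏ s ∈ Finset.univ.erase b.2, configPair t i₀ r ⟨b.1, s⟩ ω).1 -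
        (∏ s ∈ Finset.univ.erase b.2, configPair t i₀ r ⟨b.1, s⟩ ω).2) /
      ((∏ s ∈ Finset.univ.erase b.2, configPair t i₀ r ⟨b.1, s⟩ ω).1 +
        (∏ s ∈ Finset.univ.erase b.2, configPair t i₀ r ⟨b.1, s⟩ ω).2) := by
  rw [configMsg, TannerGraph.msg, prod_varNbrs hb, prod_varNbrs hb, Prod.fst_prod, Prod.snd_prod]
  rfl

section Exploration

variable {p t : Bool → ℝ} {η : ℝ} {B L K : ℕ} {i₀ : Fin n} {r c : ℕ}

/-- The partner of `b` and the flip at its check node are revealed. The good outcomes are those with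
a fresh check node: its remaining sockets are all unused and can be explored in turn by `ih`. -/
theorem simulates_configPair (hp : ∀ c, 0 ≤ p c) (hp1 : ∑ c, p c = 1) (hη0 : 0 ≤ η)
    (hη : K * B / (Fintype.card D.VarSocket : ℝ) ≤ η) (hK : ∀ i, D.chkDeg i ≤ K)
    {I : (ℝ → ℝ) → ℝ} (hI : IsMean I)
    (ih : ∀ (S : D.Cylinder) (e : D.ChkSocket), i₀ ∈ S.chks → e.1 ∈ S.chks → e ∉ S.usedChk →
      Simulates p η B c S {e} ∅ (configMsg t i₀ r e) I)
    (S : D.Cylinder) (b : D.VarSocket) (hi : i₀ ∈ S.chks) (hb : b.1 ∈ S.vars)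
    (hbu : b ∉ S.usedVar) :
    Simulates p η B (K * c + 1) S ∅ {b} (configPair t i₀ r b)
      (chkMean K D.chkEdgeFrac p t I) := by
  have hN : (0 : ℝ) < Fintype.card D.VarSocket := by
    exact_mod_cast Fintype.card_pos_iff.2 ⟨b⟩
  have hfun : chkMean K D.chkEdgeFrac p t I = fun ψ => ∑ x : D.ChkSocket × Bool,
      (1 / (Fintype.card D.VarSocket : ℝ) * p x.2) *
        convPow I (D.chkDeg x.1.1 - 1) fun y => ψ (1 + t x.2 * y, 1 - t x.2 * y) := by
    funext ψ
    rw [chkMean, ← D.sum_chkSocket hK (fun k => ∑ c, p c * convPow I (k - 1) fun y =>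
      ψ (1 + t c * y, 1 - t c * y)), Fintype.sum_prod_type]
    refine Finset.sum_congr rfl fun e _ => ?_
    rw [Finset.mul_sum]
    exact Finset.sum_congr rfl fun c _ => by ring
  rw [hfun]
  refine Simulates.branch hp hη0
    (Finset.univ.filter fun x : D.ChkSocket × Bool => x.1.1 ∉ S.chks)
    (fun x => S.revealChk b x.1 x.2 hb) _ {e | e.1 ∉ S.chks} ∅ ?_ ?_ ?_ ?_ ?_ ?_
    (fun x => (hI.convPow _).map _) ?_ ?_ (fun e he h => absurd h he) (fun _ h _ => h.elim)
  · intro x _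
    exact (Finset.filter_subset _ _).trans (Finset.filter_subset _ _)
  · intro x _ y _ hxy
    rw [Finset.disjoint_left]
    intro ω hx hy
    simp only [revealChk, Finset.mem_filter] at hx hy
    have h1 : x.1 = y.1 := ω.1.injective (hx.1.2.trans hy.1.2.symm)
    exact hxy (Prod.ext h1 (by rw [← hx.2, ← hy.2, h1]))
  · intro x hx
    have hx' : x.1.1 ∉ S.chks := by simpa using hx
    have h1 := S.mass_le_card_mul hp (fun h => hx' (S.fst_mem_chks x.1 h)) hbu
    have h2 := sum_flip (p := p) hp1 (A := S.event.filter fun ω => ω.1 x.1 = b) (j := x.1.1)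
      (fun ω hω c => by
        rw [Finset.mem_filter] at hω ⊢
        exact ⟨S.flip_mem ω hω.1 _ hx' c, hω.2⟩) x.2
    have h3 : (S.revealChk b x.1 x.2 hb).mass p =
        p x.2 * ∑ ω ∈ S.event.filter (fun ω => ω.1 x.1 = b), weight p ω := h2.symm
    rw [h3]
    have h4 : S.mass p * (1 / (Fintype.card D.VarSocket : ℝ)) ≤
        ∑ ω ∈ S.event.filter (fun ω => ω.1 x.1 = b), weight p ω := by
      rw [mul_one_div, div_le_iff₀ hN, mul_comm]
      exact h1
    calc _ = p x.2 * (S.mass p * (1 / (Fintype.card D.VarSocket : ℝ))) := by ring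
      _ ≤ _ := mul_le_mul_of_nonneg_left h4 (hp _)
  · intro x
    exact mul_nonneg (by positivity) (hp _)
  · rw [Fintype.sum_prod_type]
    simp only [← Finset.mul_sum, hp1, mul_one, Finset.sum_const, Finset.card_univ, nsmul_eq_mul]
    rw [D.card_chkSocket, mul_one_div_cancel hN.ne']
  · intro hB _
    rw [Finset.compl_filter, Finset.sum_filter, Fintype.sum_prod_type]
    simp only [not_not]
    have : ∀ e : D.ChkSocket, (∑ c, if e.1 ∈ S.chks then
        1 / (Fintype.card D.VarSocket : ℝ) * p c else 0) =
        if e.1 ∈ S.chks then 1 / (Fintype.card D.VarSocket : ℝ) else 0 := by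
      intro e
      split_ifs
      · rw [← Finset.mul_sum, hp1, mul_one]
      · simp
    rw [Finset.sum_congr rfl fun e _ => this e, ← Finset.sum_filter]
    exact sum_filter_fst_mem_le hK hB hN.le hη
  · intro x hx
    have hx' : x.1.1 ∉ S.chks := by simpa using hx
    have hprod := Simulates.prod (p := p) (B := B) (c := c)
      (S := S.revealChk b x.1 x.2 hb) (s := Finset.univ.erase x.1.2)
      (GE := fun s => {(⟨x.1.1, s⟩ : D.ChkSocket)}) (GB := fun _ => ∅)
      (f := fun s => configMsg t i₀ r ⟨x.1.1, s⟩) hη0 hI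
      (fun s S => i₀ ∈ S.chks ∧ x.1.1 ∈ S.chks ∧ (⟨x.1.1, s⟩ : D.ChkSocket) ∉ S.usedChk)
      (fun s _ S hS => ih S _ hS.1 hS.2.1 hS.2.2)
      -- Exploring below the sibling socket `s'` uses no other socket of an already explored check
      -- node, so `s` stays free.
      (fun s _ s' _ hne S S' hS hSS' => ⟨hSS'.chks_subset hS.1, hSS'.chks_subset hS.2.1,
        fun h => by
          rcases hSS'.usedChk _ h hS.2.1 with h1 | h1
          · exact hS.2.2 h1
          · rw [Set.mem_singleton_iff] at h1
            exact hne (by simpa using h1)⟩)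
      (fun s hs => ⟨Finset.mem_insert_of_mem hi, Finset.mem_insert_self _ _, fun h => by
        rcases Finset.mem_insert.1 h with h1 | h1
        · exact (Finset.mem_erase.1 hs).1 (sigma_mk_fst_eq_iff.1 h1)
        · exact hx' (S.fst_mem_chks ⟨x.1.1, s⟩ h1)⟩)
    have hcard : (Finset.univ.erase x.1.2).card = D.chkDeg x.1.1 - 1 := by
      rw [Finset.card_erase_of_mem (Finset.mem_univ _), Finset.card_univ, Fintype.card_fin]
    rw [hcard] at hprod
    have hle : (D.chkDeg x.1.1 - 1) * c ≤ K * c :=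
      Nat.mul_le_mul_right _ ((Nat.sub_le _ _).trans (hK _))
    have hmono := hprod.mono (FE' := {e | e.1 ∉ S.chks}) (FB' := ∅) hp hη0 hle
      (by
        refine Set.iUnion₂_subset fun s _ => ?_
        rintro _ rfl
        exact hx') (by simp)
    refine (hmono.map fun y => (1 + t x.2 * y, 1 - t x.2 * y)).congr fun ω hω => ?_
    simp only [revealChk, Finset.mem_filter] at hω
    have h1 : ω.1.symm b = x.1 := by rw [← hω.1.2, Equiv.symm_apply_apply]
    -- The root `i₀` is among the explored nodes, so a fresh check node is not the one whose
    -- observation is erased.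
    have h2 : softOut t i₀ ω x.1.1 = t x.2 := by
      rw [softOut, if_neg (fun h : x.1.1 = i₀ => hx' (h ▸ hi)), hω.2]
    rw [configPair, h1, h2, prod_chkNbrs]
  · intro x hx
    have hx' : x.1.1 ∉ S.chks := by simpa using hx
    refine ⟨Finset.subset_insert _ _, subset_rfl, Finset.card_insert_le _ _,
      Nat.le_succ _, fun e he h => ?_, fun b' hb' h => ?_⟩
    · rcases Finset.mem_insert.1 he with rfl | he
      · exact absurd h hx'
      · exact Or.inl he
    · rcases Finset.mem_insert.1 hb' with rfl | hb'
      · exact Or.inr rfl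
      · exact Or.inl hb'

theorem simulates_configMsg_add_two (hp : ∀ c, 0 ≤ p c) (hη0 : 0 ≤ η)
    (hη : L * B / (Fintype.card D.VarSocket : ℝ) ≤ η) (hL : ∀ a, D.varDeg a ≤ L)
    {J : (ℝ × ℝ → ℝ) → ℝ} (hJ : IsMean J)
    (ih : ∀ (S : D.Cylinder) (b : D.VarSocket), i₀ ∈ S.chks → b.1 ∈ S.vars → b ∉ S.usedVar →
      Simulates p η B c S ∅ {b} (configPair t i₀ r b) J)
    (S : D.Cylinder) (e : D.ChkSocket) (hi : i₀ ∈ S.chks) (he : e.1 ∈ S.chks)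
    (heu : e ∉ S.usedChk) :
    Simulates p η B (L * c + 1) S {e} ∅ (configMsg t i₀ (r + 2) e)
      (varMean L D.varEdgeFrac J) := by
  have hN : (0 : ℝ) < Fintype.card D.VarSocket := by
    rw [← D.card_chkSocket]
    exact_mod_cast Fintype.card_pos_iff.2 ⟨e⟩
  have hfun : varMean L D.varEdgeFrac J = fun ψ => ∑ x : D.VarSocket,
      1 / (Fintype.card D.VarSocket : ℝ) *
        convPow J (D.varDeg x.1 - 1) fun y => ψ ((y.1 - y.2) / (y.1 + y.2)) := by
    funext ψ
    rw [varMean, ← D.sum_varSocket hL (fun l => convPow J (l - 1) fun y =>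
      ψ ((y.1 - y.2) / (y.1 + y.2)))]
  rw [hfun]
  refine Simulates.branch hp hη0
    (Finset.univ.filter fun x : D.VarSocket => x.1 ∉ S.vars)
    (fun x => S.revealVar e x he) _ ∅ {b | b.1 ∉ S.vars} ?_ ?_ ?_ ?_ ?_ ?_
    (fun x => (hJ.convPow _).map _) ?_ ?_ (fun _ h _ => h.elim) (fun e he h => absurd h he)
  · intro x _
    exact Finset.filter_subset _ _
  · intro x _ y _ hxy
    rw [Finset.disjoint_left]
    intro ω hx hy
    simp only [revealVar, Finset.mem_filter] at hx hy
    exact hxy (hx.2.symm.trans hy.2)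
  · intro x hx
    have hx' : x.1 ∉ S.vars := by simpa using hx
    have h1 := S.mass_le_card_mul hp heu (fun h => hx' (S.fst_mem_vars x h))
    rw [mul_one_div, div_le_iff₀ hN, mul_comm]
    exact h1
  · intro x
    positivity
  · rw [Finset.sum_const, Finset.card_univ, nsmul_eq_mul, mul_one_div_cancel hN.ne']
  · intro _ hB
    rw [Finset.compl_filter]
    simp only [not_not]
    exact sum_filter_fst_mem_le hL hB hN.le hη
  · intro x hx
    have hx' : x.1 ∉ S.vars := by simpa using hx
    have hprod := Simulates.prod (p := p) (B := B) (c := c)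
      (S := S.revealVar e x he) (s := Finset.univ.erase x.2)
      (GE := fun _ => ∅) (GB := fun s => {(⟨x.1, s⟩ : D.VarSocket)})
      (f := fun s => configPair t i₀ r ⟨x.1, s⟩) hη0 hJ
      (fun s S => i₀ ∈ S.chks ∧ x.1 ∈ S.vars ∧ (⟨x.1, s⟩ : D.VarSocket) ∉ S.usedVar)
      (fun s _ S hS => ih S _ hS.1 hS.2.1 hS.2.2)
      (fun s _ s' _ hne S S' hS hSS' => ⟨hSS'.chks_subset hS.1, hSS'.vars_subset hS.2.1,
        fun h => by
          rcases hSS'.usedVar _ h hS.2.1 with h1 | h1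
          · exact hS.2.2 h1
          · rw [Set.mem_singleton_iff] at h1
            exact hne (by simpa using h1)⟩)
      (fun s hs => ⟨hi, Finset.mem_insert_self _ _, fun h => by
        rcases Finset.mem_insert.1 h with h1 | h1
        · exact (Finset.mem_erase.1 hs).1 (sigma_mk_fst_eq_iff.1 h1)
        · exact hx' (S.fst_mem_vars ⟨x.1, s⟩ h1)⟩)
    have hcard : (Finset.univ.erase x.2).card = D.varDeg x.1 - 1 := by
      rw [Finset.card_erase_of_mem (Finset.mem_univ _), Finset.card_univ, Fintype.card_fin]
    rw [hcard] at hprod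
    have hle : (D.varDeg x.1 - 1) * c ≤ L * c :=
      Nat.mul_le_mul_right _ ((Nat.sub_le _ _).trans (hL _))
    have hmono := hprod.mono (FE' := ∅) (FB' := {b | b.1 ∉ S.vars}) hp hη0 hle (by simp)
      (by
        refine Set.iUnion₂_subset fun s _ => ?_
        rintro _ rfl
        exact hx')
    refine (hmono.map fun y : ℝ × ℝ => (y.1 - y.2) / (y.1 + y.2)).congr fun ω hω => ?_
    simp only [revealVar, Finset.mem_filter] at hω
    rw [configMsg_eq hω.2]
  · intro x hx
    have hx' : x.1 ∉ S.vars := by simpa using hx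
    refine ⟨subset_rfl, Finset.subset_insert _ _, Nat.le_succ _, Finset.card_insert_le _ _,
      fun e' he' h => ?_, fun b' hb' h => ?_⟩
    · rcases Finset.mem_insert.1 he' with rfl | he'
      · exact Or.inr rfl
      · exact Or.inl he'
    · rcases Finset.mem_insert.1 hb' with rfl | hb'
      · exact absurd h hx'
      · exact Or.inl hb'

/-- A bound for the number of nodes that `configMsg` depends on. -/
def exploreCost (L K : ℕ) : ℕ → ℕ
  | 0 => 0
  | 1 => 0
  | r + 2 => L * (K * exploreCost L K r + 1) + 1

theorem simulates_configMsg (hp : ∀ c, 0 ≤ p c) (hp1 : ∑ c, p c = 1) (hη0 : 0 ≤ η)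
    (hηL : L * B / (Fintype.card D.VarSocket : ℝ) ≤ η)
    (hηK : K * B / (Fintype.card D.VarSocket : ℝ) ≤ η)
    (hL : ∀ a, D.varDeg a ≤ L) (hK : ∀ i, D.chkDeg i ≤ K) (hN : 0 < Fintype.card D.VarSocket) :
    ∀ r (S : D.Cylinder) (e : D.ChkSocket), i₀ ∈ S.chks → e.1 ∈ S.chks → e ∉ S.usedChk →
      Simulates p η B (exploreCost L K r) S {e} ∅ (configMsg t i₀ r e)
        (msgMean L K D.varEdgeFrac D.chkEdgeFrac p t r)
  | 0, _, _, _, _, _ => simulates_const 1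
  | 1, _, _, _, _, _ => simulates_const 0
  | r + 2, S, e, hi, he, heu => by
    have hI := isMean_msgMean (t := t) D.varEdgeFrac_nonneg (D.sum_varEdgeFrac hL hN)
      D.chkEdgeFrac_nonneg (D.sum_chkEdgeFrac hK hN) hp hp1 r
    have ih := simulates_configMsg hp hp1 hη0 hηL hηK hL hK hN r
    exact simulates_configMsg_add_two hp hη0 hηL hL
      (hI.chkMean D.chkEdgeFrac_nonneg (D.sum_chkEdgeFrac hK hN) hp hp1)
      (simulates_configPair hp hp1 hη0 hηK hK hI ih) S e hi he heu

end Exploration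

end NodeDegrees

/-! ### From the ensemble average to the mean over a random tree. -/

namespace NodeDegrees

open DensityEvolution Cylinder

variable {n m : ℕ} {D : NodeDegrees n m}

theorem prod_chkEdges (σ : D.ChkSocket ≃ D.VarSocket) (i : Fin n) (g : D.ChkSocket → ℝ) :
    ∏ e ∈ (D.graph σ).chkEdges i, g e = ∏ s, g ⟨i, s⟩ := by
  symm
  refine Finset.prod_bij (fun s _ => ⟨i, s⟩) ?_ ?_ ?_ fun _ _ => rfl
  · intro s _
    exact TannerGraph.mem_chkEdges.2 rfl
  · intro s₁ _ s₂ _ h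
    simpa using h
  · rintro ⟨j, s⟩ h
    obtain rfl : j = i := TannerGraph.mem_chkEdges.1 h
    exact ⟨s, Finset.mem_univ _, rfl⟩

theorem card_chkEdges (σ : D.ChkSocket ≃ D.VarSocket) (i : Fin n) :
    ((D.graph σ).chkEdges i).card = D.chkDeg i := by
  -- A product of the constant 2 counts factors: equal powers of 2 have equal exponents.
  have := prod_chkEdges σ i fun _ => 2
  rw [Finset.prod_const, Finset.prod_const, Finset.card_univ, Fintype.card_fin] at this
  exact pow_right_injective₀ two_pos (by norm_num) this

theorem card_chkNbrs_le (σ : D.ChkSocket ≃ D.VarSocket) (e : D.ChkSocket) :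
    ((D.graph σ).chkNbrs e).card ≤ D.chkDeg e.1 := by
  have := prod_chkNbrs (σ, fun _ => true) e fun _ => 2
  rw [Finset.prod_const, Finset.prod_const] at this
  rw [pow_right_injective₀ two_pos (by norm_num) this]
  exact (Finset.card_le_univ _).trans (by simp)

theorem card_varNbrs_le (σ : D.ChkSocket ≃ D.VarSocket) (e : D.ChkSocket) :
    ((D.graph σ).varNbrs e).card ≤ D.varDeg (σ e).1 := by
  have := prod_varNbrs (ω := (σ, fun _ => true)) (e := e) rfl fun _ => 2
  rw [Finset.prod_const, Finset.prod_const] at this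
  rw [pow_right_injective₀ two_pos (by norm_num) this]
  exact (Finset.card_le_univ _).trans (by simp)

/-- The start of the exploration at the check node `i`. -/
def rootCylinder (D : NodeDegrees n m) (i : Fin n) : D.Cylinder where
  event := Finset.univ
  usedChk := ∅
  usedVar := ∅
  chks := {i}
  vars := ∅
  mem_used := by simp
  swap_mem := by simp
  flip_mem := by simp
  fst_mem_chks := by simp
  fst_mem_vars := by simp

theorem mean_rootCylinder (p : Bool → ℝ) (i : Fin n) (f : D.Config → ℝ) :
    (D.rootCylinder i).mean p f =
      ∑ σ : D.ChkSocket ≃ D.VarSocket, ∑ s : Fin n → Bool, (∏ j, p (s j)) * f (σ, s) := 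
  Fintype.sum_prod_type _

theorem mass_rootCylinder {p : Bool → ℝ} (hp1 : ∑ c, p c = 1) (i : Fin n) :
    (D.rootCylinder i).mass p = Fintype.card (D.ChkSocket ≃ D.VarSocket) := by
  have h1 : (D.rootCylinder i).mass p = (D.rootCylinder i).mean p fun _ => 1 := by
    simp [Cylinder.mean, Cylinder.mass]
  have h2 : ∑ s : Fin n → Bool, ∏ j, p (s j) = 1 := by
    rw [← Fintype.piFinset_univ, ← Finset.prod_univ_sum, hp1, Finset.prod_const_one]
  rw [h1, mean_rootCylinder]
  simp [h2]

/-- The extrinsic estimate at `i` in the graph of a configuration. -/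
def configSoftBit (t : Bool → ℝ) (i : Fin n) (d : ℕ) (ω : D.Config) : ℝ :=
  ∏ s : Fin (D.chkDeg i), configMsg t i d ⟨i, s⟩ ω

theorem extrinsicSoftBit_graph (ε : ℝ) (σ : D.ChkSocket ≃ D.VarSocket) (s : Fin n → Bool)
    (i : Fin n) (d : ℕ) :
    (D.graph σ).extrinsicSoftBit d (fun j => bscLLR ε (s j)) i =
      configSoftBit (fun c => Real.tanh (bscLLR ε c)) i d (σ, s) := by
  rw [TannerGraph.extrinsicSoftBit_eq_prod_msg, prod_chkEdges, configSoftBit]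
  have : (fun j => Real.tanh (Function.update (fun j => bscLLR ε (s j)) i 0 j)) =
      softOut (D := D) (fun c => Real.tanh (bscLLR ε c)) i (σ, s) := by
    funext j
    by_cases h : j = i
    · subst h; simp [softOut]
    · simp [softOut, h]
  simp only [configMsg, ← this]
  congr!

section Mean

variable {p t : Bool → ℝ} {η : ℝ} {B L K : ℕ}

theorem simulates_configSoftBit (hp : ∀ c, 0 ≤ p c) (hp1 : ∑ c, p c = 1) (hη0 : 0 ≤ η)
    (hηL : L * B / (Fintype.card D.VarSocket : ℝ) ≤ η)
    (hηK : K * B / (Fintype.card D.VarSocket : ℝ) ≤ η)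
    (hL : ∀ a, D.varDeg a ≤ L) (hK : ∀ i, D.chkDeg i ≤ K) (hN : 0 < Fintype.card D.VarSocket)
    (d : ℕ) (i : Fin n) :
    Simulates p η B (K * exploreCost L K d) (D.rootCylinder i) Set.univ ∅ (configSoftBit t i d)
      (convPow (msgMean L K D.varEdgeFrac D.chkEdgeFrac p t d) (D.chkDeg i)) := by
  have hI := isMean_msgMean (t := t) D.varEdgeFrac_nonneg (D.sum_varEdgeFrac hL hN)
      D.chkEdgeFrac_nonneg (D.sum_chkEdgeFrac hK hN) hp hp1 d
  have hprod := Simulates.prod (p := p) (B := B) (c := exploreCost L K d)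
      (S := D.rootCylinder i) (s := Finset.univ)
      (GE := fun s => {(⟨i, s⟩ : D.ChkSocket)}) (GB := fun _ => ∅)
      (f := fun s => configMsg t i d ⟨i, s⟩) hη0 hI
      (fun s S => i ∈ S.chks ∧ (⟨i, s⟩ : D.ChkSocket) ∉ S.usedChk)
      (fun s _ S hS =>
        simulates_configMsg hp hp1 hη0 hηL hηK hL hK hN d S _ hS.1 hS.1 hS.2)
      (fun s _ s' _ hne S S' hS hSS' => ⟨hSS'.chks_subset hS.1,
        fun h => by
          rcases hSS'.usedChk _ h hS.1 with h1 | h1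
          · exact hS.2 h1
          · rw [Set.mem_singleton_iff] at h1
            exact hne (by simpa using h1)⟩)
      (fun s _ => ⟨Finset.mem_singleton_self _, Finset.notMem_empty _⟩)
  rw [Finset.card_univ, Fintype.card_fin] at hprod
  exact hprod.mono hp hη0 (Nat.mul_le_mul_right _ (hK _)) (Set.subset_univ _) (by simp)

/-- The simulation is run from the root with the trivial continuation `φ` and no slack. The summand
1 in `B` accounts for the root, which counts as explored from the start. -/
theorem mean_configSoftBit_ge (hp : ∀ c, 0 ≤ p c) (hp1 : ∑ c, p c = 1)
    (hL : ∀ a, D.varDeg a ≤ L) (hK : ∀ i, D.chkDeg i ≤ K) (hN : 0 < Fintype.card D.VarSocket)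
    (d : ℕ) (i : Fin n) (hB : B = K * exploreCost L K d + 1)
    (hη : η = (L + K) * B / (Fintype.card D.VarSocket : ℝ))
    {φ : ℝ → ℝ} (h0 : ∀ x, 0 ≤ φ x) (h1 : ∀ x, φ x ≤ 1) :
    Fintype.card (D.ChkSocket ≃ D.VarSocket) *
      (convPow (msgMean L K D.varEdgeFrac D.chkEdgeFrac p t d) (D.chkDeg i) φ - B * η) ≤
      (D.rootCylinder i).mean p fun ω => φ (configSoftBit t i d ω) := by
  have hη0 : 0 ≤ η := by rw [hη]; positivity
  have hηL : L * B / (Fintype.card D.VarSocket : ℝ) ≤ η := by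
    rw [hη]
    gcongr
    exact le_add_of_nonneg_right (Nat.cast_nonneg K)
  have hηK : K * B / (Fintype.card D.VarSocket : ℝ) ≤ η := by
    rw [hη]
    gcongr
    exact le_add_of_nonneg_left (Nat.cast_nonneg L)
  have key := simulates_configSoftBit (t := t) hp hp1 hη0 hηL hηK hL hK hN d i
    (by simp [rootCylinder, hB, add_comm]) (by simp [rootCylinder, hB]) (fun x _ => φ x) φ 0
    (fun x _ => h0 x) h1 le_rfl (fun x S' _ => by
      rw [sub_zero, Cylinder.mass, Cylinder.mean, Finset.sum_mul])
  rw [mass_rootCylinder hp1, sub_zero] at key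
  refine le_trans (mul_le_mul_of_nonneg_left ?_ (Nat.cast_nonneg _)) key
  have : ((K * exploreCost L K d : ℕ) : ℝ) * η ≤ B * η := by
    refine mul_le_mul_of_nonneg_right ?_ hη0
    rw [hB]
    exact_mod_cast Nat.le_succ _
  linarith

/-- The one-sided bound for test functions with values in [0, 1] is applied to 1/2 + φ/(2M) and 1/2
- φ/(2M). Both sides are affine in the test function, so the two results bound the difference from
both sides. -/
theorem abs_mean_configSoftBit_sub_le (hp : ∀ c, 0 ≤ p c) (hp1 : ∑ c, p c = 1)
    (hL : ∀ a, D.varDeg a ≤ L) (hK : ∀ i, D.chkDeg i ≤ K) (hN : 0 < Fintype.card D.VarSocket)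
    (d : ℕ) (i : Fin n) (hB : B = K * exploreCost L K d + 1)
    (hη : η = (L + K) * B / (Fintype.card D.VarSocket : ℝ))
    {φ : ℝ → ℝ} {M : ℝ} (hM : 0 < M) (hφ : ∀ x, |φ x| ≤ M) :
    |(D.rootCylinder i).mean p (fun ω => φ (configSoftBit t i d ω)) -
      Fintype.card (D.ChkSocket ≃ D.VarSocket) *
        convPow (msgMean L K D.varEdgeFrac D.chkEdgeFrac p t d) (D.chkDeg i) φ| ≤
      Fintype.card (D.ChkSocket ≃ D.VarSocket) * (2 * M * (B * η)) := by
  set I := convPow (msgMean L K D.varEdgeFrac D.chkEdgeFrac p t d) (D.chkDeg i) with hI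
  have hmean : IsMean I := (isMean_msgMean (t := t) D.varEdgeFrac_nonneg (D.sum_varEdgeFrac hL hN)
      D.chkEdgeFrac_nonneg (D.sum_chkEdgeFrac hK hN) hp hp1 d).convPow _
  set E : ℝ := (Fintype.card (D.ChkSocket ≃ D.VarSocket) : ℝ)
  have hlin : ∀ b : ℝ, (D.rootCylinder i).mean p
      (fun ω => 1 / 2 + b * φ (configSoftBit t i d ω)) =
      E / 2 + b * (D.rootCylinder i).mean p (fun ω => φ (configSoftBit t i d ω)) := by
    intro b
    have h := mass_rootCylinder (D := D) hp1 i
    simp only [Cylinder.mean, mul_add, Finset.sum_add_distrib, ← Finset.sum_mul, Finset.mul_sum]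
    rw [← Cylinder.mass, h, mul_one_div]
    congr 1
    exact Finset.sum_congr rfl fun _ _ => by ring
  have hbound : ∀ b : ℝ, |b| = 1 / (2 * M) → ∀ x, |b * φ x| ≤ 1 / 2 := by
    intro b hb x
    rw [abs_mul, hb]
    calc 1 / (2 * M) * |φ x| ≤ 1 / (2 * M) * M := by gcongr; exact hφ x
      _ = 1 / 2 := by field_simp
  have key : ∀ b : ℝ, |b| = 1 / (2 * M) → E * (b * I φ - B * η) ≤
      b * (D.rootCylinder i).mean p (fun ω => φ (configSoftBit t i d ω)) := by
    intro b hb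
    have := mean_configSoftBit_ge (t := t) hp hp1 hL hK hN d i hB hη
      (φ := fun x => 1 / 2 + b * φ x)
      (fun x => by linarith [(abs_le.1 (hbound b hb x)).1])
      (fun x => by linarith [(abs_le.1 (hbound b hb x)).2])
    rw [← hI, hmean.affine, hlin] at this
    linarith
  have hpos : (0 : ℝ) < 1 / (2 * M) := by positivity
  have h1 := key (1 / (2 * M)) (abs_of_pos hpos)
  have h2 := key (-(1 / (2 * M))) (by rw [abs_neg, abs_of_pos hpos])
  set Y := (D.rootCylinder i).mean p (fun ω => φ (configSoftBit t i d ω))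
  have h3 : ∀ z : ℝ, 2 * M * (1 / (2 * M) * z) = z := fun z => by field_simp
  have h1' := mul_le_mul_of_nonneg_left h1 (by positivity : (0:ℝ) ≤ 2 * M)
  have h2' := mul_le_mul_of_nonneg_left h2 (by positivity : (0:ℝ) ≤ 2 * M)
  have e1 : 2 * M * (E * (1 / (2 * M) * I φ - B * η)) = E * I φ - E * (2 * M * (B * η)) := by
    field_simp
  have e2 : 2 * M * (E * (-(1 / (2 * M)) * I φ - B * η)) =
      -(E * I φ) - E * (2 * M * (B * η)) := by
    field_simp
  have e3 : 2 * M * (-(1 / (2 * M)) * Y) = -Y := by field_simp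
  rw [e1, h3] at h1'
  rw [e2, e3] at h2'
  rw [abs_le]
  constructor <;> linarith

end Mean

/-- The limiting value of the ensemble average of a function of the extrinsic estimates. -/
def treeMean (L K : ℕ) (lam rho root : ℕ → ℝ) (p t : Bool → ℝ) (d : ℕ) (φ : ℝ → ℝ) : ℝ :=
  ∑ k ∈ Finset.range (K + 1), root k * convPow (msgMean L K lam rho p t d) k φ

/-- The fraction of check nodes of degree `k`. -/
def chkFrac (D : NodeDegrees n m) (k : ℕ) : ℝ :=
  (Finset.univ.filter fun i => D.chkDeg i = k).card / n

theorem sum_bscProb (ε : ℝ) : ∑ c, bscProb ε c = 1 := by simp [bscProb]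

/-- The error in the approximation of the ensemble by random trees. -/
theorem abs_ensembleAvg_sub_treeMean_le {L K : ℕ} {ε : ℝ} (h0 : 0 ≤ ε) (h1 : ε ≤ 1)
    (hL : ∀ a, D.varDeg a ≤ L) (hK : ∀ i, D.chkDeg i ≤ K) (hN : 0 < Fintype.card D.VarSocket)
    (hn : 0 < n) (d : ℕ) {B : ℕ} (hB : B = K * exploreCost L K d + 1)
    {φ : ℝ → ℝ} {M : ℝ} (hM : 0 < M) (hφ : ∀ x, |φ x| ≤ M) :
    |D.ensembleAvg (fun G i => bscExpect ε fun l => φ (G.extrinsicSoftBit d l i)) -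
      treeMean L K D.varEdgeFrac D.chkEdgeFrac D.chkFrac (bscProb ε)
        (fun c => Real.tanh (bscLLR ε c)) d φ| ≤
      2 * M * (B * ((L + K) * B / (Fintype.card D.VarSocket : ℝ))) := by
  set t : Bool → ℝ := fun c => Real.tanh (bscLLR ε c) with ht
  have hp : ∀ c, 0 ≤ bscProb ε c := by
    intro c
    cases c <;> simp [bscProb] <;> linarith
  have hE : (0 : ℝ) < Fintype.card (D.ChkSocket ≃ D.VarSocket) := by
    have : Nonempty (D.ChkSocket ≃ D.VarSocket) :=
      ⟨Fintype.equivOfCardEq D.card_chkSocket⟩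
    exact_mod_cast Fintype.card_pos
  have hn' : (0 : ℝ) < n := by exact_mod_cast hn
  have hmean : ∀ i, ∑ σ : D.ChkSocket ≃ D.VarSocket,
      (bscExpect ε fun l => φ ((D.graph σ).extrinsicSoftBit d l i)) =
      (D.rootCylinder i).mean (bscProb ε) fun ω => φ (configSoftBit t i d ω) := by
    intro i
    rw [mean_rootCylinder]
    refine Finset.sum_congr rfl fun σ _ => ?_
    unfold bscExpect
    refine Finset.sum_congr rfl fun s _ => ?_
    simp only [extrinsicSoftBit_graph, ht]
  have hfirst : D.ensembleAvg (fun G i => bscExpect ε fun l => φ (G.extrinsicSoftBit d l i)) =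
      (∑ i, (D.rootCylinder i).mean (bscProb ε) fun ω => φ (configSoftBit t i d ω)) / n /
        Fintype.card (D.ChkSocket ≃ D.VarSocket) := by
    rw [ensembleAvg, ← Finset.sum_div, Finset.sum_comm]
    simp only [hmean]
  -- The tree mean depends on the root only through its degree, so the sum over check nodes can be
  -- grouped by degree.
  have hsecond : treeMean L K D.varEdgeFrac D.chkEdgeFrac D.chkFrac (bscProb ε) t d φ =
      (∑ i, Fintype.card (D.ChkSocket ≃ D.VarSocket) *
        convPow (msgMean L K D.varEdgeFrac D.chkEdgeFrac (bscProb ε) t d) (D.chkDeg i) φ) / n /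
        Fintype.card (D.ChkSocket ≃ D.VarSocket) := by
    rw [← Finset.mul_sum, mul_div_assoc, mul_div_cancel_left₀ _ hE.ne', treeMean,
      ← Finset.sum_fiberwise_of_maps_to (t := Finset.range (K + 1)) (g := D.chkDeg)
        fun a _ => Finset.mem_range.2 (Nat.lt_succ_of_le (hK a)), Finset.sum_div]
    refine Finset.sum_congr rfl fun k _ => ?_
    rw [Finset.sum_congr rfl fun i hi => by rw [(Finset.mem_filter.1 hi).2], Finset.sum_const,
      nsmul_eq_mul, chkFrac]
    ring
  rw [hfirst, hsecond, ← sub_div, ← sub_div, ← Finset.sum_sub_distrib, div_div, abs_div,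
    abs_of_pos (mul_pos hn' hE), div_le_iff₀ (mul_pos hn' hE)]
  refine (Finset.abs_sum_le_sum_abs _ _).trans ?_
  refine (Finset.sum_le_sum fun i _ => abs_mean_configSoftBit_sub_le hp (sum_bscProb ε) hL hK hN d
    i hB rfl hM hφ).trans_eq ?_
  rw [Finset.sum_const, Finset.card_univ, Fintype.card_fin, nsmul_eq_mul]
  ring

theorem contConv_treeMean {L K : ℕ} {lam rho root : ℕ → ℝ} {p t : Bool → ℝ}
    {lamk rhok rootk : ℕ → ℕ → ℝ}
    (hl : ∀ l, Tendsto (fun k => lamk k l) atTop (𝓝 (lam l)))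
    (hr : ∀ l, Tendsto (fun k => rhok k l) atTop (𝓝 (rho l)))
    (hs : ∀ l, Tendsto (fun k => rootk k l) atTop (𝓝 (root l))) (d : ℕ) (φ : ℝ → ℝ) :
    Tendsto (fun k => treeMean L K (lamk k) (rhok k) (rootk k) p t d φ) atTop
      (𝓝 (treeMean L K lam rho root p t d φ)) :=
  tendsto_finsetSum _ fun l _ => (hs l).mul
    ((contConv_msgMean hl hr d).convPow l (fun _ => φ) φ fun _ => tendsto_const_nhds)

end NodeDegrees

/-! ### The limits in the depth and in the block length. -/

namespace NodeDegrees

open DensityEvolution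

variable {n m : ℕ} {D : NodeDegrees n m}

theorem abs_ensembleAvg_le {f : TannerGraph (Fin m) (Fin n) D.ChkSocket → Fin n → ℝ} {M : ℝ}
    (hM : 0 ≤ M) (hf : ∀ σ i, |f (D.graph σ) i| ≤ M) : |D.ensembleAvg f| ≤ M := by
  have h1 : ∀ σ : D.ChkSocket ≃ D.VarSocket, |(∑ i, f (D.graph σ) i) / (n : ℝ)| ≤ M := by
    intro σ
    rw [abs_div, Nat.abs_cast]
    refine div_le_of_le_mul₀ (Nat.cast_nonneg _) hM ?_
    refine (Finset.abs_sum_le_sum_abs _ _).trans ((Finset.sum_le_sum fun i _ => hf σ i).trans_eq ?_)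
    rw [Finset.sum_const, Finset.card_univ, Fintype.card_fin, nsmul_eq_mul, mul_comm]
  rw [ensembleAvg, abs_div, Nat.abs_cast]
  refine div_le_of_le_mul₀ (Nat.cast_nonneg _) hM ?_
  refine (Finset.abs_sum_le_sum_abs _ _).trans ((Finset.sum_le_sum fun σ _ => h1 σ).trans_eq ?_)
  rw [Finset.sum_const, Finset.card_univ, nsmul_eq_mul, mul_comm]

theorem ensembleAvg_sub (f g : TannerGraph (Fin m) (Fin n) D.ChkSocket → Fin n → ℝ) :
    D.ensembleAvg f - D.ensembleAvg g = D.ensembleAvg fun G i => f G i - g G i := by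
  simp only [ensembleAvg, Finset.sum_sub_distrib, sub_div]

theorem ensembleAvg_const_mul (c : ℝ)
    (f : TannerGraph (Fin m) (Fin n) D.ChkSocket → Fin n → ℝ) :
    D.ensembleAvg (fun G i => c * f G i) = c * D.ensembleAvg f := by
  simp only [ensembleAvg, ← Finset.mul_sum, mul_div_assoc]

theorem abs_bscExpect_le {C : Type} [Fintype C] [DecidableEq C] {ε : ℝ} (h0 : 0 ≤ ε) (h1 : ε ≤ 1)
    {F : (C → ℝ) → ℝ} {M : ℝ} (hF : ∀ s : C → Bool, |F fun j => bscLLR ε (s j)| ≤ M) :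
    |bscExpect ε F| ≤ M := by
  have hp : ∀ c, 0 ≤ bscProb ε c := by
    intro c
    cases c <;> simp [bscProb] <;> linarith
  have hsum : ∑ s : C → Bool, ∏ j, bscProb ε (s j) = 1 := by
    rw [← Fintype.piFinset_univ, ← Finset.prod_univ_sum, sum_bscProb, Finset.prod_const_one]
  refine (Finset.abs_sum_le_sum_abs _ _).trans ?_
  calc ∑ s : C → Bool, |(∏ j, bscProb ε (s j)) * F fun j => bscLLR ε (s j)|
      ≤ ∑ s : C → Bool, (∏ j, bscProb ε (s j)) * M := by
        refine Finset.sum_le_sum fun s _ => ?_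
        have hs : 0 ≤ ∏ j, bscProb ε (s j) := Finset.prod_nonneg fun _ _ => hp _
        rw [abs_mul, abs_of_nonneg hs]
        exact mul_le_mul_of_nonneg_left (hF s) hs
    _ = M := by rw [← Finset.sum_mul, hsum, one_mul]

theorem bscExpect_sub {C : Type} [Fintype C] [DecidableEq C] (ε : ℝ) (F G : (C → ℝ) → ℝ) :
    bscExpect ε F - bscExpect ε G = bscExpect ε fun l => F l - G l := by
  simp only [bscExpect, mul_sub, Finset.sum_sub_distrib]

/-- The estimates lie in [-1, 1], so the clamped kernel may replace the original one; it is bounded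
on all of ℝ, as the comparison with random trees requires. -/
theorem bpGexit_eq (Λ P : Polynomial ℝ) (d : ℕ) {ε : ℝ} (h0 : 0 < ε) (h1 : ε < 1) :
    D.bpGexit Λ P d ε = Λ.derivative.eval 1 / P.derivative.eval 1 *
      D.ensembleAvg fun G i => bscExpect ε fun l =>
        clampedKernel ε (G.extrinsicSoftBit d l i) := by
  rw [← ensembleAvg_const_mul]
  unfold bpGexit
  congr 1
  funext G i
  rw [bscDerivMean_bscExpect h0 h1 fun l => G.abs_extrinsicSoftBit_le_one d l i]
  simp only [clampedKernel_eq (TannerGraph.abs_extrinsicSoftBit_le_one G d _ i)]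

theorem exists_abs_bpGexit_le (Λ P : Polynomial ℝ) {ε : ℝ} (h0 : 0 < ε) (h1 : ε < 1) :
    ∃ B, ∀ d, |D.bpGexit Λ P d ε| ≤ B := by
  obtain ⟨M, hM, h⟩ := exists_abs_clampedKernel_le h0 h1
  refine ⟨|Λ.derivative.eval 1 / P.derivative.eval 1| * M, fun d => ?_⟩
  rw [bpGexit_eq Λ P d h0 h1, abs_mul]
  exact mul_le_mul_of_nonneg_left (abs_ensembleAvg_le hM.le fun σ i =>
    abs_bscExpect_le h0.le h1.le fun s => h _) (abs_nonneg _)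

/-- At high noise, the GEXIT functions form a Cauchy sequence in the depth `d`, uniformly over all
degree assignments with bounded degrees. -/
theorem exists_abs_bpGexit_sub_le (lmax kmax : ℕ) (Λ P : Polynomial ℝ) {ε : ℝ}
    (h0 : 0 < ε) (h1 : ε < 1 / 2) (hε : 1 - 2 * ε ≤ 1 / (4 * 3 ^ lmax * lmax * kmax + 2))
    {η : ℝ} (hη : 0 < η) :
    ∃ d₀, ∀ (n m : ℕ) (D : NodeDegrees n m), (∀ a, D.varDeg a ≤ lmax) →
      (∀ i, D.chkDeg i ≤ kmax) → ∀ d d', d₀ ≤ d → d₀ ≤ d' →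
      |D.bpGexit Λ P d ε - D.bpGexit Λ P d' ε| ≤ η := by
  have h1' : ε < 1 := by linarith
  set c : ℝ := Λ.derivative.eval 1 / P.derivative.eval 1 with hc
  obtain ⟨δ, hδ, hunif⟩ := exists_gexitKernel_uniform h0 h1'
    -- The summand 1 keeps the quotient meaningful when the prefactor `c` vanishes.
    (show 0 < η / (|c| + 1) by positivity)
  have hlim : Tendsto (fun j : ℕ => (kmax : ℝ) * (2 * (1 / 2) ^ j)) atTop (𝓝 0) := by
    have := (tendsto_pow_atTop_nhds_zero_of_lt_one (r := (1 / 2 : ℝ)) (by norm_num)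
      (by norm_num)).const_mul 2 |>.const_mul (kmax : ℝ)
    simpa using this
  obtain ⟨j, hj⟩ := (hlim.eventually_lt_const hδ).exists
  refine ⟨2 * j, fun n m D hL hK d d' hd hd' => ?_⟩
  rw [bpGexit_eq Λ P d h0 h1', bpGexit_eq Λ P d' h0 h1', ← mul_sub, ensembleAvg_sub, abs_mul, ← hc]
  have hX : |D.ensembleAvg fun G i =>
      (bscExpect ε fun l => clampedKernel ε (G.extrinsicSoftBit d l i)) -
        bscExpect ε fun l => clampedKernel ε (G.extrinsicSoftBit d' l i)| ≤ η / (|c| + 1) := by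
    refine abs_ensembleAvg_le (by positivity) fun σ i => ?_
    rw [bscExpect_sub]
    refine abs_bscExpect_le h0.le h1'.le fun s => ?_
    rw [clampedKernel_eq (TannerGraph.abs_extrinsicSoftBit_le_one _ _ _ _),
      clampedKernel_eq (TannerGraph.abs_extrinsicSoftBit_le_one _ _ _ _)]
    refine (hunif _ _ (TannerGraph.abs_extrinsicSoftBit_le_one _ _ _ _)
      (TannerGraph.abs_extrinsicSoftBit_le_one _ _ _ _) ?_).le
    refine lt_of_le_of_lt (TannerGraph.abs_extrinsicSoftBit_sub_le (D.graph σ) (L := lmax)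
      (K := kmax) (fun e => (card_varNbrs_le σ e).trans (hL _))
      (fun e => (card_chkNbrs_le σ e).trans (hK _)) (fun v => ?_)
      ((card_chkEdges σ i).le.trans (hK i)) hd hd') hj
    rcases s v
    · rw [tanh_bscLLR_false h0 h1', abs_of_nonneg (by linarith)]
      exact hε
    · rw [tanh_bscLLR_true h0 h1', abs_neg, abs_of_nonneg (by linarith)]
      exact hε
  calc |c| * _ ≤ |c| * (η / (|c| + 1)) := mul_le_mul_of_nonneg_left hX (abs_nonneg _)
    _ ≤ (|c| + 1) * (η / (|c| + 1)) := by gcongr; linarith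
    _ = η := by field_simp

/-- The convergence of the edge perspective degree distributions. -/
theorem tendsto_edgeFrac {m : ℕ → ℕ} {deg : ∀ k, Fin (m k) → ℕ} {L : ℕ}
    (hL : ∀ k a, deg k a ≤ L) {v : ℕ → ℝ}
    (h : ∀ j, Tendsto (fun k =>
      ((Finset.univ.filter fun a => deg k a = j).card : ℝ) / (m k : ℝ)) atTop (𝓝 (v j)))
    (hv : ∑ j ∈ Finset.range (L + 1), j * v j ≠ 0) (l : ℕ) :
    Tendsto (fun k => l * ((Finset.univ.filter fun a => deg k a = l).card : ℝ) /
      ((∑ a, deg k a : ℕ) : ℝ)) atTop (𝓝 (l * v l / ∑ j ∈ Finset.range (L + 1), j * v j)) := by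
  have h1 : ∀ k, (l * ((Finset.univ.filter fun a => deg k a = l).card : ℝ) /
      ((∑ a, deg k a : ℕ) : ℝ)) =
      l * (((Finset.univ.filter fun a => deg k a = l).card : ℝ) / (m k : ℝ)) /
        ∑ j ∈ Finset.range (L + 1),
          j * (((Finset.univ.filter fun a => deg k a = j).card : ℝ) / (m k : ℝ)) := by
    intro k
    have h2 : ((∑ a, deg k a : ℕ) : ℝ) = ∑ j ∈ Finset.range (L + 1),
        j * ((Finset.univ.filter fun a => deg k a = j).card : ℝ) := by
      rw [← Finset.sum_fiberwise_of_maps_to (t := Finset.range (L + 1)) (g := deg k)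
        fun a _ => Finset.mem_range.2 (Nat.lt_succ_of_le (hL k a))]
      push_cast
      refine Finset.sum_congr rfl fun j _ => ?_
      rw [Finset.sum_congr rfl fun a ha => by rw [(Finset.mem_filter.1 ha).2], Finset.sum_const,
        nsmul_eq_mul, mul_comm]
    rw [h2]
    simp only [← mul_div_assoc, ← Finset.sum_div]
    -- Without nodes both sides vanish because the count in the numerator does.
    rcases Nat.eq_zero_or_pos (m k) with hm | hm
    · have : (Finset.univ.filter fun a => deg k a = l).card = 0 := by
        have := Finset.card_le_univ (Finset.univ.filter fun a => deg k a = l)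
        rw [Fintype.card_fin] at this
        omega
      simp [this]
    · have : (m k : ℝ) ≠ 0 := by positivity
      rw [div_div_div_cancel_right₀ this]
  simp only [h1]
  exact ((h l).const_mul _).div (tendsto_finsetSum _ fun j _ => (h j).const_mul _) hv

/-- No mass sits at degree 0, so the mean degree is at least the total mass 1. -/
theorem sum_mul_coeff_pos {L : ℕ} {Λ : Polynomial ℝ} (h : IsDegreeDist L Λ) :
    0 < ∑ j ∈ Finset.range (L + 1), j * Λ.coeff j := by
  have h1 : ∑ j ∈ Finset.range (L + 1), Λ.coeff j = 1 := by
    have := Polynomial.eval_eq_sum_range' (Nat.lt_succ_of_le h.natDegree_le) 1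
    simpa [h.eval_one] using this.symm
  refine lt_of_lt_of_le one_pos (h1 ▸ Finset.sum_le_sum fun j _ => ?_)
  rcases Nat.eq_zero_or_pos j with rfl | hj
  · simp [h.coeff_zero]
  · exact le_mul_of_one_le_left (h.coeff_nonneg j) (by exact_mod_cast hj)

theorem tendsto_varEdgeFrac {lmax kmax : ℕ} {Λ P : Polynomial ℝ} {n m : ℕ → ℕ}
    {D : ∀ k, NodeDegrees (n k) (m k)} (h : IsLDGMSequence lmax kmax Λ P n m D)
    (hΛ : IsDegreeDist lmax Λ) (l : ℕ) :
    Tendsto (fun k => (D k).varEdgeFrac l) atTop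
      (𝓝 (l * Λ.coeff l / ∑ j ∈ Finset.range (lmax + 1), j * Λ.coeff j)) := by
  simp only [varEdgeFrac, card_varSocket]
  exact tendsto_edgeFrac (fun k a => (h.varDeg_mem k a).2) h.tendsto_var
    (sum_mul_coeff_pos hΛ).ne' l

theorem tendsto_chkEdgeFrac {lmax kmax : ℕ} {Λ P : Polynomial ℝ} {n m : ℕ → ℕ}
    {D : ∀ k, NodeDegrees (n k) (m k)} (h : IsLDGMSequence lmax kmax Λ P n m D)
    (hP : IsDegreeDist kmax P) (l : ℕ) :
    Tendsto (fun k => (D k).chkEdgeFrac l) atTop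
      (𝓝 (l * P.coeff l / ∑ j ∈ Finset.range (kmax + 1), j * P.coeff j)) := by
  simp only [chkEdgeFrac, card_varSocket, ← (D _).sum_eq]
  exact tendsto_edgeFrac (fun k a => (h.chkDeg_mem k a).2) h.tendsto_chk
    (sum_mul_coeff_pos hP).ne' l

/-- The ensemble averages converge, as the block length tends to infinity, for a fixed depth. -/
theorem exists_tendsto_bpGexit {lmax kmax : ℕ} {Λ P : Polynomial ℝ} {n m : ℕ → ℕ}
    {D : ∀ k, NodeDegrees (n k) (m k)} (h : IsLDGMSequence lmax kmax Λ P n m D)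
    (hΛ : IsDegreeDist lmax Λ) (hP : IsDegreeDist kmax P) {ε : ℝ} (h0 : 0 < ε) (h1 : ε < 1)
    (d : ℕ) : ∃ g, Tendsto (fun k => (D k).bpGexit Λ P d ε) atTop (𝓝 g) := by
  obtain ⟨M, hM, hφ⟩ := exists_abs_clampedKernel_le h0 h1
  set B : ℕ := kmax * exploreCost lmax kmax d + 1 with hB
  have hlim := contConv_treeMean (L := lmax) (K := kmax) (p := bscProb ε)
    (t := fun c => Real.tanh (bscLLR ε c)) (tendsto_varEdgeFrac h hΛ) (tendsto_chkEdgeFrac h hP)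
    (rootk := fun k => (D k).chkFrac) (root := P.coeff) h.tendsto_chk d (clampedKernel ε)
  -- Every check node has degree at least 1, so the number of edges tends to infinity. With `d`, and
  -- hence `B`, fixed, the collision error vanishes.
  have hcard : ∀ k, n k ≤ Fintype.card (D k).VarSocket := by
    intro k
    rw [card_varSocket, ← (D k).sum_eq]
    calc n k = ∑ _i : Fin (n k), 1 := by simp
      _ ≤ _ := Finset.sum_le_sum fun i _ => (h.chkDeg_mem k i).1
  have hN : Tendsto (fun k => (Fintype.card (D k).VarSocket : ℝ)) atTop atTop :=
    tendsto_natCast_atTop_atTop.comp (tendsto_atTop_mono hcard h.tendsto_n)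
  have herr : Tendsto (fun k => 2 * M * (B * ((lmax + kmax) * B /
      (Fintype.card (D k).VarSocket : ℝ)))) atTop (𝓝 0) := by
    have := ((tendsto_const_nhds (x := ((lmax : ℝ) + kmax) * B)).div_atTop hN).const_mul
      (B : ℝ) |>.const_mul (2 * M)
    simpa using this
  have hdiff : Tendsto (fun k =>
      (D k).ensembleAvg (fun G i => bscExpect ε fun l =>
        clampedKernel ε (G.extrinsicSoftBit d l i)) -
      treeMean lmax kmax (D k).varEdgeFrac (D k).chkEdgeFrac (D k).chkFrac (bscProb ε)
        (fun c => Real.tanh (bscLLR ε c)) d (clampedKernel ε)) atTop (𝓝 0) := by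
    refine squeeze_zero_norm' ?_ herr
    filter_upwards [h.tendsto_n.eventually_gt_atTop 0] with k hk
    exact abs_ensembleAvg_sub_treeMean_le h0.le h1.le (fun a => (h.varDeg_mem k a).2)
      (fun i => (h.chkDeg_mem k i).2) (lt_of_lt_of_le hk (hcard k)) hk d hB hM hφ
  have hsum := (hdiff.add hlim).const_mul (Λ.derivative.eval 1 / P.derivative.eval 1)
  refine ⟨_, hsum.congr fun k => ?_⟩
  rw [sub_add_cancel, bpGexit_eq Λ P d h0 h1]

end NodeDegrees

/-- The Moore–Osgood theorem for a double sequence that is Cauchy in `d` uniformly in `k`. -/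
theorem exists_exchange_of_limits {f : ℕ → ℕ → ℝ}
    (hlim : ∀ d, ∃ g, Tendsto (fun k => f k d) atTop (𝓝 g))
    (hcauchy : ∀ η > 0, ∃ d₀, ∀ k d d', d₀ ≤ d → d₀ ≤ d' → |f k d - f k d'| ≤ η) :
    ∃ L : ℝ, (∃ g : ℕ → ℝ, (∀ d, Tendsto (fun k => f k d) atTop (𝓝 (g d))) ∧
        Tendsto g atTop (𝓝 L)) ∧
      Tendsto (fun k => limsup (f k) atTop) atTop (𝓝 L) ∧
      Tendsto (fun k => liminf (f k) atTop) atTop (𝓝 L) := by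
  choose g hg using hlim
  have hF : ∀ k, ∃ F, Tendsto (f k) atTop (𝓝 F) := by
    intro k
    refine cauchySeq_tendsto_of_complete (Metric.cauchySeq_iff'.2 fun η hη => ?_)
    obtain ⟨d₀, hd₀⟩ := hcauchy (η / 2) (by positivity)
    exact ⟨d₀, fun d hd => (hd₀ k d d₀ hd le_rfl).trans_lt (by linarith)⟩
  choose F hF using hF
  have hunif : TendstoUniformly (fun d k => f k d) F atTop := by
    rw [Metric.tendstoUniformly_iff]
    intro η hη
    obtain ⟨d₀, hd₀⟩ := hcauchy (η / 2) (by positivity)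
    filter_upwards [eventually_ge_atTop d₀] with d hd k
    have h1 : |F k - f k d| ≤ η / 2 := by
      refine le_of_tendsto ((hF k).sub_const (f k d)).abs ?_
      filter_upwards [eventually_ge_atTop d₀] with d' hd'
      exact hd₀ k d' d hd' hd
    exact h1.trans_lt (by linarith)
  have hgc : ∃ L, Tendsto g atTop (𝓝 L) := by
    refine cauchySeq_tendsto_of_complete (Metric.cauchySeq_iff'.2 fun η hη => ?_)
    obtain ⟨d₀, hd₀⟩ := hcauchy (η / 2) (by positivity)
    refine ⟨d₀, fun d hd => ?_⟩
    have h1 : |g d - g d₀| ≤ η / 2 :=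
      le_of_tendsto ((hg d).sub (hg d₀)).abs (Eventually.of_forall fun k => hd₀ k d d₀ hd le_rfl)
    exact h1.trans_lt (by linarith)
  obtain ⟨L, hL⟩ := hgc
  have hFL : Tendsto F atTop (𝓝 L) :=
    (hunif.tendstoUniformlyOnFilter.mono_right le_top).tendsto_of_eventually_tendsto
      (Eventually.of_forall hg) hL
  -- Each sequence in the depth converges, so its limsup and liminf both equal its limit `F k`.
  exact ⟨L, ⟨g, hg, hL⟩, hFL.congr fun k => (hF k).limsup_eq.symm,
    hFL.congr fun k => (hF k).liminf_eq.symm⟩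

end

theorem theorem2 (lmax kmax : ℕ) :
    ∃ ε₀ : ℝ, 0 ≤ ε₀ ∧ ε₀ < 1 / 2 ∧
      ∀ (Λ P : Polynomial ℝ), IsDegreeDist lmax Λ → IsDegreeDist kmax P →
      ∀ (n m : ℕ → ℕ) (D : ∀ k, NodeDegrees (n k) (m k)), IsLDGMSequence lmax kmax Λ P n m D →
      ∀ ε : ℝ, ε₀ < ε → ε < 1 / 2 →
        -- for each block length the sequence in `d` is bounded, so that its limsup and liminf
        -- are genuine real numbers
        (∀ k, ∃ B : ℝ, ∀ d, |(D k).bpGexit Λ P d ε| ≤ B) ∧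
        ∃ L : ℝ,
          (∃ g : ℕ → ℝ,
            (∀ d, Tendsto (fun k => (D k).bpGexit Λ P d ε) atTop (𝓝 (g d))) ∧
            Tendsto g atTop (𝓝 L)) ∧
          Tendsto (fun k => limsup (fun d => (D k).bpGexit Λ P d ε) atTop) atTop (𝓝 L) ∧
          Tendsto (fun k => liminf (fun d => (D k).bpGexit Λ P d ε) atTop) atTop (𝓝 L) := by

  set τ : ℝ := 1 / (4 * 3 ^ lmax * lmax * kmax + 2) with hτ
  have hden : (2 : ℝ) ≤ 4 * 3 ^ lmax * lmax * kmax + 2 := by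
    have : (0 : ℝ) ≤ 4 * 3 ^ lmax * lmax * kmax := by positivity
    linarith
  have hτ0 : 0 < τ := by positivity
  have hτ1 : τ ≤ 1 / 2 := one_div_le_one_div_of_le two_pos hden
  -- Above this noise level `1 - 2 * ε < τ`, the size of soft outputs for which the messages
  -- contract.
  refine ⟨(1 - τ) / 2, by linarith, by linarith, ?_⟩
  intro Λ P hΛ hP n m D hD ε hε₀ hε
  have h0 : 0 < ε := by linarith
  have h1 : ε < 1 := by linarith
  refine ⟨fun k => NodeDegrees.exists_abs_bpGexit_le Λ P h0 h1, ?_⟩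
  refine exists_exchange_of_limits (f := fun k d => (D k).bpGexit Λ P d ε)
    (fun d => NodeDegrees.exists_tendsto_bpGexit hD hΛ hP h0 h1 d) fun η hη => ?_
  obtain ⟨d₀, hd₀⟩ := NodeDegrees.exists_abs_bpGexit_sub_le lmax kmax Λ P h0 hε
    (by linarith) hη
  exact ⟨d₀, fun k d d' => hd₀ (n k) (m k) (D k) (fun a => (hD.varDeg_mem k a).2)
    (fun i => (hD.chkDeg_mem k i).2) d d'⟩
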